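/- A rooted map is a connected graph (loops and multiple edges allowed) embedded in an oriented surface, i.e. given together with the counterclockwise cyclic order of the edge ends around each vertex, in which one edge has been oriented; the edge end at the head of the root edge is called the root end. The map with one vertex and no edges also counts as a rooted map. Rooted maps are considered up to orientation- and root-preserving isomorphism. A rooted map has weight $\prod_v \mathrm{wt}(v)$, where the vertex at the head of the root edge (the only vertex, if there are no edges) has weight $1$ and every other vertex has weight $c$, an indeterminate; so a rooted map with $k$ vertices has weight $c^{k-1}$. A complete matching on $[N]=\{1,\dots,N\}$ is connected if every point other than $1$ and $N$ is nested by an edge, i.e. lies strictly between the two ends of some edge. An edge $\{a<b\}$ is nested by an edge $\{a'<b'\}$ if $a'<a$ and $b<b'$. The weight of a connected matching is $c^m$, where $m$ is the number of its edges that are not nested by any edge and do not contain the point $1$. To a rooted map with $n$ edges one associates a matching on $[2n+2]$ as follows (the function of Ossona de Mendez and Rosenstiehl). Add a new loop $\alpha$ at the vertex incident with the root end, so that its tail and then its head come immediately before the root end in the counterclockwise order. Starting at the head of $\alpha$, list the edge ends counterclockwise around this vertex, ending with the tail of $\alpha$. As long as some listed edge end has an unlisted opposite end, take the first such edge end in the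 list, let $e$ be its opposite end, and append to the list the edge ends around the vertex of $e$ in counterclockwise order, beginning with the one after $e$ and ending with $e$. The resulting list has $2n+2$ entries; the matching joins positions $i$ and $j$ whenever the $i$-th and $j$-th entries are the two ends of the same edge. **Theorem.** This function preserves weight, and for all integers $n\ge 0$ and $k\ge 1$ it is a bijection from the set of (isomorphism classes of) rooted maps in orientable surfaces with $k$ vertices and $n$ edges to the set of connected matchings on $2n+2$ points of weight $c^{k-1}$. -/

import Mathlib

/-! ### Complete matchings on `N` points on a line

The points `1, …, N` are the elements `0, …, N - 1` of `Fin N`, and an edge is the pair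
`(left end, right end)`. -/

/-- `E` is the set of edges of a complete matching: every point lies on exactly one edge. -/
def IsCompleteMatching {N : ℕ} (E : Finset (Fin N × Fin N)) : Prop :=
  (∀ e ∈ E, e.1 < e.2) ∧ ∀ v : Fin N, ∃! e, e ∈ E ∧ (e.1 = v ∨ e.2 = v)

/-- A connected matching: a complete matching in which all points, except the first and the last
one, are nested by an edge. -/
def IsConnectedMatching {N : ℕ} (E : Finset (Fin N × Fin N)) : Prop :=
  IsCompleteMatching E ∧
    ∀ v : Fin N, v.val ≠ 0 → v.val + 1 ≠ N → ∃ e ∈ E, e.1 < v ∧ v < e.2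

/-- The edge `e` is not nested by any edge of `E`. -/
def IsNonnested {N : ℕ} (E : Finset (Fin N × Fin N)) (e : Fin N × Fin N) : Prop :=
  ¬ ∃ f ∈ E, f.1 < e.1 ∧ e.2 < f.2

open Classical in
/-- The weight of a matching, a polynomial in the indeterminate `c = Polynomial.X`: every nonnested
edge has weight `c`, except the edge that contains the first point; all other edges have
weight `1`. -/
noncomputable def matchingWeight {N : ℕ} (E : Finset (Fin N × Fin N)) : Polynomial ℤ :=
  ∏ e ∈ E, if IsNonnested E e ∧ ¬ (e.1.val = 0 ∨ e.2.val = 0) then Polynomial.X else 1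

/-! ### Rooted maps in orientable surfaces -/

/-- A rooted map with `n` edges and `k` vertices in an oriented surface, as a connected graph with
a rotation system: `D` is the set of half-edges (edge ends), `V` the set of vertices, `opp`
exchanges the two ends of each edge, and `rot` sends a half-edge to the next one counterclockwise
around its vertex. Loops and multiple edges are allowed. Orienting an edge amounts to choosing
the end that is its head; this half-edge is `root`. The map with one vertex and no edge has no
half-edge to choose, and counts as rooted. -/
structure RootedMap (n k : ℕ) where
  /-- half-edges -/
  D : Type
  /-- vertices -/
  V : Type
  [fintypeD : Fintype D]
  [fintypeV : Fintype V]
  [nonemptyV : Nonempty V]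
  card_D : Fintype.card D = 2 * n
  card_V : Fintype.card V = k
  /-- the other end of the same edge -/
  opp : D → D
  opp_opp : ∀ d, opp (opp d) = d
  opp_ne : ∀ d, opp d ≠ d
  /-- the vertex with which a half-edge is incident -/
  vert : D → V
  /-- the next half-edge counterclockwise around the same vertex -/
  rot : Equiv.Perm D
  vert_eq_iff : ∀ x y, vert x = vert y ↔ rot.SameCycle x y
  /-- the underlying graph is connected -/
  connected : ∀ u v : V, Relation.ReflTransGen (fun a b => ∃ d, vert d = a ∧ vert (opp d) = b) u v
  /-- the head of the root edge -/
  root : Option D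
  isEmpty_of_root : root = none → IsEmpty D

namespace RootedMap

variable {n k : ℕ}

attribute [instance] fintypeD fintypeV nonemptyV

/-- An (orientation-preserving, root-preserving) isomorphism of rooted maps. -/
structure Iso (M M' : RootedMap n k) where
  /-- the bijection of half-edges -/
  onD : M.D ≃ M'.D
  /-- the bijection of vertices -/
  onV : M.V ≃ M'.V
  opp_comm : ∀ d, onD (M.opp d) = M'.opp (onD d)
  rot_comm : ∀ d, onD (M.rot d) = M'.rot (onD d)
  vert_comm : ∀ d, onV (M.vert d) = M'.vert (onD d)
  root_comm : M.root.map onD = M'.root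

/-- Rooted maps are considered up to isomorphism. -/
instance setoid (n k : ℕ) : Setoid (RootedMap n k) where
  r M M' := Nonempty (Iso M M')
  iseqv :=
    { refl := fun M => ⟨⟨Equiv.refl _, Equiv.refl _, fun _ => rfl, fun _ => rfl, fun _ => rfl,
        by simp⟩⟩
      symm := by
        rintro M M' ⟨f⟩
        refine ⟨⟨f.onD.symm, f.onV.symm, fun d => ?_, fun d => ?_, fun d => ?_, ?_⟩⟩
        · rw [Equiv.symm_apply_eq, f.opp_comm, Equiv.apply_symm_apply]
        · rw [Equiv.symm_apply_eq, f.rot_comm, Equiv.apply_symm_apply]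
        · rw [Equiv.symm_apply_eq, f.vert_comm, Equiv.apply_symm_apply]
        · rw [← f.root_comm]
          simp
      trans := by
        rintro M M' M'' ⟨f⟩ ⟨g⟩
        refine ⟨⟨f.onD.trans g.onD, f.onV.trans g.onV, fun d => ?_, fun d => ?_, fun d => ?_, ?_⟩⟩
        · simp [f.opp_comm, g.opp_comm]
        · simp [f.rot_comm, g.rot_comm]
        · simp [f.vert_comm, g.vert_comm]
        · rw [← g.root_comm, ← f.root_comm]
          simp }

open Classical in
/-- The weight of a rooted map: every vertex has weight `c = Polynomial.X`, except the one at the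
head of the root edge. (In the map without edges the only vertex has weight `1`.) -/
noncomputable def weight (M : RootedMap n k) : Polynomial ℤ :=
  ∏ v : M.V, if ∀ r ∈ M.root, M.vert r = v then 1 else Polynomial.X

/-! ### The bijection

First a new loop is added at the head of the root edge. -/

/-- The half-edges of the map with the additional loop. -/
abbrev D' (M : RootedMap n k) : Type := M.D ⊕ Bool

/-- The head of the additional loop. -/
def loopHead (M : RootedMap n k) : M.D' := Sum.inr true

/-- The tail of the additional loop. -/
def loopTail (M : RootedMap n k) : M.D' := Sum.inr false

/-- The other end of the same edge, in the map with the additional loop. -/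
def opp' (M : RootedMap n k) : M.D' → M.D' := Sum.map M.opp Bool.not

open Classical in
/-- The rotation of the map with the additional loop: tail and head of the loop, in this order,
are inserted just before the root half-edge in the counterclockwise order around its vertex, so
that the order becomes `…, rot⁻¹ r, loopTail, loopHead, r, rot r, …`. (In the map without edges the
loop is put on the only vertex.) -/
noncomputable def rot' (M : RootedMap n k) : Equiv.Perm M.D' :=
  let σ : Equiv.Perm M.D' := Equiv.sumCongr M.rot (Equiv.refl Bool)
  match M.root with
  | none => Equiv.swap M.loopTail M.loopHead * σ
  | some r => Equiv.swap M.loopTail M.loopHead * (Equiv.swap M.loopHead (Sum.inl r) * σ)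

/-- All half-edges around the vertex of `e`, once each, in counterclockwise order, starting with
the one after `e` and ending with `e` itself. -/
noncomputable def around (M : RootedMap n k) (e : M.D') : List M.D' :=
  (List.range (Function.minimalPeriod M.rot' e)).map fun i => M.rot'^[i + 1] e

open Classical in
/-- One step of the algorithm: take the first half-edge in the list whose opposite is not in the
list (this is the leftmost unattached point of the matching built so far), move to that opposite,
and append all the half-edges around its vertex. If there is none, everything has been visited
and nothing is done. -/
noncomputable def step (M : RootedMap n k) (w : List M.D') : List M.D' :=
  match w.find? (fun d => decide (M.opp' d ∉ w)) with
  | none => w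
  | some d => w ++ M.around (M.opp' d)

/-- The list of all half-edges in the order in which they are visited, starting with the head of
the additional loop. Replacing every half-edge by its edge gives the double occurrence word.
(Every effective step visits a new vertex, so `k` steps are enough.) -/
noncomputable def visits (M : RootedMap n k) : List M.D' :=
  M.step^[k] (M.around M.loopTail)

open Classical in
/-- The matching of the double occurrence word: it joins the two positions of each edge. -/
noncomputable def toMatching (M : RootedMap n k) :
    Finset (Fin (2 * n + 2) × Fin (2 * n + 2)) :=
  Finset.univ.filter fun p => p.1 < p.2 ∧
    ∃ d : M.D', M.visits[p.1.val]? = some d ∧ M.visits[p.2.val]? = some (M.opp' d)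

/-! The matching depends only on the isomorphism class. -/

namespace Iso

variable {M M' : RootedMap n k}

/-- An isomorphism extends to the maps with the additional loops. -/
def onD' (f : Iso M M') : M.D' ≃ M'.D' := Equiv.sumCongr f.onD (Equiv.refl Bool)

theorem opp'_comm (f : Iso M M') (d : M.D') : f.onD' (M.opp' d) = M'.opp' (f.onD' d) := by
  rcases d with d | b
  · simp [onD', opp', f.opp_comm]
  · simp [onD', opp']

theorem rot'_comm (f : Iso M M') (d : M.D') : f.onD' (M.rot' d) = M'.rot' (f.onD' d) := by
  classical
  have hσ : ∀ d : M.D', f.onD' (Equiv.sumCongr M.rot (Equiv.refl Bool) d) =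
      Equiv.sumCongr M'.rot (Equiv.refl Bool) (f.onD' d) := by
    rintro (d | b)
    · simp [onD', f.rot_comm]
    · simp [onD']
  have hsw : ∀ a b x : M.D', f.onD' (Equiv.swap a b x) =
      Equiv.swap (f.onD' a) (f.onD' b) (f.onD' x) := fun a b x =>
    (f.onD'.injective.map_swap a b x)
  have hh : f.onD' M.loopHead = M'.loopHead := rfl
  have ht : f.onD' M.loopTail = M'.loopTail := rfl
  have hr := f.root_comm
  unfold rot'
  cases hM : M.root with
  | none =>
    rw [hM] at hr
    rw [← hr]
    simp only [Option.map_none, Equiv.Perm.mul_apply]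
    rw [← hσ, ← hh, ← ht]
    convert hsw _ _ _ using 2
  | some r =>
    rw [hM] at hr
    rw [← hr]
    simp only [Option.map_some, Equiv.Perm.mul_apply]
    rw [← hσ, ← hh, ← ht]
    have hl : (Sum.inl (f.onD r) : M'.D') = f.onD' (Sum.inl r) := rfl
    rw [hl]
    convert hsw _ _ _ using 2
    convert (hsw _ _ _).symm using 2

theorem around_comm (f : Iso M M') (e : M.D') :
    (M.around e).map f.onD' = M'.around (f.onD' e) := by
  have hs : Function.Semiconj f.onD' M.rot' M'.rot' := f.rot'_comm
  have hp : Function.minimalPeriod M'.rot' (f.onD' e) = Function.minimalPeriod M.rot' e := by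
    refine Function.minimalPeriod_eq_minimalPeriod_iff.2 fun m => ?_
    unfold Function.IsPeriodicPt Function.IsFixedPt
    rw [← (hs.iterate_right m) e, f.onD'.injective.eq_iff]
  unfold around
  rw [hp, List.map_map]
  refine List.map_congr_left fun i _ => ?_
  exact (hs.iterate_right (i + 1)) e

theorem step_comm (f : Iso M M') (w : List M.D') :
    (M.step w).map f.onD' = M'.step (w.map f.onD') := by
  classical
  have hfind : (w.map f.onD').find? (fun d => decide (M'.opp' d ∉ w.map f.onD')) =
      (w.find? (fun d => decide (M.opp' d ∉ w))).map f.onD' := by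
    rw [List.find?_map]
    congr 2
    funext d
    simp only [Function.comp_apply, ← f.opp'_comm,
      List.mem_map_of_injective f.onD'.injective]
  unfold step
  have h2 := hfind
  cases hw : w.find? (fun d => decide (M.opp' d ∉ w)) with
  | none =>
    rw [hw] at h2
    simp only [Option.map_none] at h2
    convert rfl using 1
    convert congrArg (fun o => match o with
      | none => w.map f.onD'
      | some d => w.map f.onD' ++ M'.around (M'.opp' d)) h2 using 1
  | some d =>
    rw [hw] at h2
    simp only [Option.map_some] at h2
    rw [List.map_append, f.around_comm, f.opp'_comm]
    symm
    convert congrArg (fun o => match o with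
      | none => w.map f.onD'
      | some d => w.map f.onD' ++ M'.around (M'.opp' d)) h2 using 1

theorem visits_comm (f : Iso M M') : M.visits.map f.onD' = M'.visits := by
  have hs : Function.Semiconj (List.map f.onD') M.step M'.step := f.step_comm
  have h := (hs.iterate_right k) (M.around M.loopTail)
  rw [f.around_comm] at h
  exact h

theorem toMatching_eq (f : Iso M M') : M.toMatching = M'.toMatching := by
  classical
  ext p
  simp only [toMatching, Finset.mem_filter, Finset.mem_univ, true_and, ← f.visits_comm,
    List.getElem?_map]
  refine and_congr_right fun _ => ⟨?_, ?_⟩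
  · rintro ⟨d, h1, h2⟩
    exact ⟨f.onD' d, by rw [h1]; rfl, by rw [h2, ← f.opp'_comm]; rfl⟩
  · rintro ⟨d, h1, h2⟩
    obtain ⟨a, ha, rfl⟩ := Option.map_eq_some_iff.1 h1
    obtain ⟨b, hb, hb'⟩ := Option.map_eq_some_iff.1 h2
    rw [← f.opp'_comm] at hb'
    exact ⟨a, ha, by rw [hb, f.onD'.injective hb']⟩

end Iso

/-- Rooted maps with `n` edges and `k` vertices in orientable surfaces, up to isomorphism. -/
abbrev Class (n k : ℕ) : Type 1 := Quotient (RootedMap.setoid n k)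

/-- The function of Ossona de Mendez and Rosenstiehl. -/
noncomputable def Class.toMatching (n k : ℕ) (q : Class n k) :
    Finset (Fin (2 * n + 2) × Fin (2 * n + 2)) :=
  Quotient.lift RootedMap.toMatching (fun _ _ h => Nonempty.elim h fun f => f.toMatching_eq) q

end RootedMap

/-! Each effective step of the exploration appends the block of a new vertex, and this block ends
with the half-edge through which the vertex was reached. The opposite of that half-edge is the
leftmost point so far unattached, so all points to its left are matched before the block. Hence the
edge that ends a block is nonnested. Conversely, a point other than 0 that does not end its block
lies under the edge that does, and if it is a right end, its whole edge is nested by that edge. So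
the blocks end exactly at the right ends of nonnested edges (`rightEnds`), one for each vertex. This
gives the weight: the edge of the first point is the added loop, and it is discounted just as the
root vertex is. The matching is connected because a point inside a block is nested by the edge
ending its block, and the end of a block by the edge ending the next one. All this is
`exists_isLabelling`.

Injectivity: the matching determines the blocks, hence the rotation (the cyclic successor inside
blocks, `IsBlockSucc`) and the opposites (the partners). The map with the loop is thus recovered,
and the loop can be removed from an isomorphism (`nonempty_iso`).

Surjectivity: cut a connected matching after each element of `rightEnds` and let the blocks be the
vertices. By connectedness the edge ending a block starts in an earlier block, at the leftmost point
matched beyond the preceding blocks (`map_lt_of_next`). So the graph is connected, and its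
exploration reads the points in their given order (`visits_eq_ofFn`). Removing the edge of the first
point (`LoopedMap`) leaves the required rooted map. -/

/-! ### Matchings as fixed point free involutions -/

/-- `E` is the set of edges of the matching given by the involution `ι`. -/
structure IsMatchingOf {N : ℕ} (E : Finset (Fin N × Fin N)) (ι : Fin N → Fin N) : Prop where
  invol : ∀ p, ι (ι p) = p
  ne : ∀ p, ι p ≠ p
  mem_iff : ∀ p q, (p, q) ∈ E ↔ p < q ∧ ι p = q

/-- The right ends of the nonnested edges of the matching given by `ι`. -/
def rightEnds {N : ℕ} (ι : Fin N → Fin N) : Finset (Fin N) :=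
  Finset.univ.filter fun b => ι b < b ∧ ∀ a < ι b, ι a < b

/-- If `Fin N` is cut into blocks, the last points of which form the set `T`, then `s` is the
cyclic successor of `i` inside its block. -/
def IsBlockSucc {N : ℕ} (T : Finset (Fin N)) (i s : Fin N) : Prop :=
  (i ∉ T ∧ s.val = i.val + 1) ∨
    (i ∈ T ∧ s ≤ i ∧ (∀ t ∈ T, t < i → t < s) ∧ (s.val = 0 ∨ ∃ t ∈ T, t.val + 1 = s.val))

theorem mem_rightEnds {N : ℕ} {ι : Fin N → Fin N} {b : Fin N} :
    b ∈ rightEnds ι ↔ ι b < b ∧ ∀ a < ι b, ι a < b := by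
  simp [rightEnds]

theorem IsCompleteMatching.exists_isMatchingOf {N : ℕ} {E : Finset (Fin N × Fin N)}
    (h : IsCompleteMatching E) : ∃ ι, IsMatchingOf E ι := by
  obtain ⟨hlt, hex⟩ := h
  have key : ∀ v : Fin N, ∃ u, (v, u) ∈ E ∨ (u, v) ∈ E := by
    intro v
    obtain ⟨⟨a, b⟩, ⟨he, h1⟩, -⟩ := hex v
    rcases h1 with rfl | rfl
    · exact ⟨b, Or.inl he⟩
    · exact ⟨a, Or.inr he⟩
  choose ι hι using key
  have uniq : ∀ v u u' : Fin N, ((v, u) ∈ E ∨ (u, v) ∈ E) → ((v, u') ∈ E ∨ (u', v) ∈ E) →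
      u = u' := by
    intro v u u' h1 h2
    have hu := fun e e' : Fin N × Fin N => (hex v).unique (y₁ := e) (y₂ := e')
    rcases h1 with h1 | h1 <;> rcases h2 with h2 | h2
    · have := hu _ _ ⟨h1, Or.inl rfl⟩ ⟨h2, Or.inl rfl⟩
      simpa using this
    · have := hu _ _ ⟨h1, Or.inl rfl⟩ ⟨h2, Or.inr rfl⟩
      have h3 := hlt _ h1
      simp only [Prod.mk.injEq] at this
      simp [this.2] at h3
    · have := hu _ _ ⟨h1, Or.inr rfl⟩ ⟨h2, Or.inl rfl⟩
      have h3 := hlt _ h1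
      simp only [Prod.mk.injEq] at this
      simp [this.1] at h3
    · have := hu _ _ ⟨h1, Or.inr rfl⟩ ⟨h2, Or.inr rfl⟩
      simpa using this
  refine ⟨ι, fun p => uniq (ι p) _ _ (hι _) (hι p).symm, fun p hp => ?_, fun p q => ⟨?_, ?_⟩⟩
  · have := hι p
    rw [hp, or_self] at this
    exact absurd (hlt _ this) (lt_irrefl _)
  · exact fun he => ⟨hlt _ he, uniq p _ _ (hι p) (Or.inl he)⟩
  · rintro ⟨hpq, rfl⟩
    rcases hι p with h1 | h1
    · exact h1
    · exact absurd (hlt _ h1) hpq.asymm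

namespace IsMatchingOf

variable {N : ℕ} {E : Finset (Fin N × Fin N)} {ι : Fin N → Fin N}

theorem injective (h : IsMatchingOf E ι) : Function.Injective ι :=
  Function.LeftInverse.injective h.invol

theorem isCompleteMatching (h : IsMatchingOf E ι) : IsCompleteMatching E := by
  refine ⟨fun e he => ((h.mem_iff e.1 e.2).1 he).1, fun v => ?_⟩
  rcases lt_or_gt_of_ne (h.ne v) with hv | hv
  · refine ⟨(ι v, v), ⟨(h.mem_iff _ _).2 ⟨hv, h.invol v⟩, Or.inr rfl⟩, ?_⟩
    rintro ⟨a, b⟩ ⟨he, rfl | rfl⟩ <;> obtain ⟨h1, h2⟩ := (h.mem_iff _ _).1 he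
    · rw [h2] at hv
      exact absurd hv h1.asymm
    · simp [← h2, h.invol]
  · refine ⟨(v, ι v), ⟨(h.mem_iff _ _).2 ⟨hv, rfl⟩, Or.inl rfl⟩, ?_⟩
    rintro ⟨a, b⟩ ⟨he, rfl | rfl⟩ <;> obtain ⟨h1, h2⟩ := (h.mem_iff _ _).1 he
    · simp [← h2]
    · simp only [← h2, h.invol] at hv h1
      exact absurd hv h1.asymm

theorem isConnectedMatching_iff (h : IsMatchingOf E ι) : IsConnectedMatching E ↔
    ∀ v : Fin N, v.val ≠ 0 → v.val + 1 ≠ N → ∃ a, a < v ∧ v < ι a := by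
  refine ⟨fun hE v h0 h1 => ?_, fun hE => ⟨h.isCompleteMatching, fun v h0 h1 => ?_⟩⟩
  · obtain ⟨⟨a, b⟩, he, hl, hr⟩ := hE.2 v h0 h1
    exact ⟨a, hl, by rwa [((h.mem_iff _ _).1 he).2]⟩
  · obtain ⟨a, hl, hr⟩ := hE v h0 h1
    exact ⟨(a, ι a), (h.mem_iff _ _).2 ⟨hl.trans hr, rfl⟩, hl, hr⟩

/-- `rightEnds` quantifies over all points left of the edge, not only over left ends. This changes
nothing, since a right end there has its partner even further left. -/
theorem isNonnested_iff (h : IsMatchingOf E ι) {e : Fin N × Fin N} (he : e ∈ E) :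
    IsNonnested E e ↔ e.2 ∈ rightEnds ι := by
  obtain ⟨a, b⟩ := e
  obtain ⟨hab, rfl⟩ := (h.mem_iff _ _).1 he
  simp only [mem_rightEnds, h.invol, IsNonnested, hab, true_and, not_exists, not_and, not_lt]
  constructor
  · intro h1 c hc
    rcases lt_or_ge (ι c) c with h2 | h2
    · exact h2.trans (hc.trans hab)
    · refine lt_of_le_of_ne (h1 (c, ι c) ((h.mem_iff _ _).2 ⟨lt_of_le_of_ne h2 (h.ne c).symm, rfl⟩)
        hc) fun h3 => ?_
      exact hc.ne (h.injective h3)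
  · rintro h1 ⟨c, d⟩ hcd hc
    obtain ⟨-, rfl⟩ := (h.mem_iff _ _).1 hcd
    exact (h1 c hc).le

theorem map_zero_mem_rightEnds (h : IsMatchingOf E ι) [NeZero N] : ι 0 ∈ rightEnds ι := by
  rw [mem_rightEnds, h.invol]
  exact ⟨Fin.pos_iff_ne_zero.2 (h.ne 0), fun a ha => absurd ha (Fin.not_lt_zero a)⟩

/-- Nonnested edges correspond to their right ends. The one subtracted is `ι 0`, whose edge contains
the first point. -/
theorem matchingWeight_eq (h : IsMatchingOf E ι) [NeZero N] :
    matchingWeight E = Polynomial.X ^ ((rightEnds ι).card - 1) := by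
  classical
  unfold matchingWeight
  rw [Finset.prod_ite, Finset.prod_const_one, mul_one, Finset.prod_const]
  congr 1
  rw [← Finset.card_erase_of_mem h.map_zero_mem_rightEnds]
  refine Finset.card_bij (fun e _ => e.2) ?_ ?_ ?_
  · rintro ⟨a, b⟩ he
    obtain ⟨hE, hn, h0⟩ := Finset.mem_filter.1 he
    refine Finset.mem_erase.2 ⟨?_, (h.isNonnested_iff hE).1 hn⟩
    rintro (rfl : b = ι 0)
    refine h0 (Or.inl ?_)
    have := h.injective ((h.mem_iff _ _).1 hE).2
    simp [this]
  · rintro ⟨a, b⟩ he ⟨a', b'⟩ he' (rfl : b = b')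
    have h1 := ((h.mem_iff _ _).1 (Finset.mem_filter.1 he).1).2
    have h2 := ((h.mem_iff _ _).1 (Finset.mem_filter.1 he').1).2
    rw [h.injective (h1.trans h2.symm)]
  · intro b hb
    obtain ⟨hb0, hb⟩ := Finset.mem_erase.1 hb
    have hlt := (mem_rightEnds.1 hb).1
    have hE : (ι b, b) ∈ E := (h.mem_iff _ _).2 ⟨hlt, h.invol b⟩
    refine ⟨(ι b, b), Finset.mem_filter.2 ⟨hE, (h.isNonnested_iff hE).2 hb, ?_⟩, rfl⟩
    rintro (h1 | h1)
    · have h1 : ι b = 0 := Fin.ext (by simpa using h1)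
      exact hb0 (by rw [← h1, h.invol])
    · rw [Fin.lt_def] at hlt
      simp only at h1
      omega

theorem matchingWeight_eq_iff (h : IsMatchingOf E ι) [NeZero N] {k : ℕ} (hk : 1 ≤ k) :
    matchingWeight E = Polynomial.X ^ (k - 1) ↔ (rightEnds ι).card = k := by
  rw [h.matchingWeight_eq]
  have h1 : 0 < (rightEnds ι).card := Finset.card_pos.2 ⟨_, h.map_zero_mem_rightEnds⟩
  constructor
  · intro h2
    have := congrArg Polynomial.natDegree h2
    simp only [Polynomial.natDegree_X_pow] at this
    omega
  · rintro rfl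
    rfl

end IsMatchingOf

/-! ### Cyclic successors inside blocks -/

namespace IsBlockSucc

variable {N : ℕ} {T : Finset (Fin N)}

theorem unique {i s s' : Fin N} (h : IsBlockSucc T i s) (h' : IsBlockSucc T i s') : s = s' := by
  rcases h with ⟨h1, h2⟩ | ⟨h1, h2, h3, h4⟩ <;> rcases h' with ⟨h1', h2'⟩ | ⟨h1', h2', h3', h4'⟩
  · omega
  · exact absurd h1' h1
  · exact absurd h1 h1'
  · rcases lt_trichotomy s s' with h5 | h5 | h5
    · rcases h4' with h4' | ⟨t, ht, h4'⟩
      · omega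
      · have := h3 t ht (by omega)
        omega
    · exact h5
    · rcases h4 with h4 | ⟨t, ht, h4⟩
      · omega
      · have := h3' t ht (by omega)
        omega

/-- A successor of a point outside `T` is neither 0 nor just after a point of `T`, so the two cases
cannot mix. Two block ends with the same block start agree, as no end lies between the start and
either of them. -/
theorem injective {i j s : Fin N} (h : IsBlockSucc T i s) (h' : IsBlockSucc T j s) : i = j := by
  rcases h with ⟨h1, h2⟩ | ⟨h1, h2, h3, h4⟩ <;> rcases h' with ⟨h1', h2'⟩ | ⟨h1', h2', h3', h4'⟩
  · omega
  · rcases h4' with h4' | ⟨t, ht, h4'⟩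
    · omega
    · exact absurd ((show t = i by omega) ▸ ht) h1
  · rcases h4 with h4 | ⟨t, ht, h4⟩
    · omega
    · exact absurd ((show t = j by omega) ▸ ht) h1'
  · rcases lt_trichotomy i j with h5 | h5 | h5
    · have := h3' i h1 h5
      omega
    · exact h5
    · have := h3 j h1' h5
      omega

end IsBlockSucc

theorem exists_isBlockSucc {N : ℕ} {T : Finset (Fin N)}
    (hT : ∀ i : Fin N, i.val + 1 = N → i ∈ T) (i : Fin N) : ∃ s, IsBlockSucc T i s := by
  by_cases hi : i ∈ T
  · rcases (T.filter (· < i)).eq_empty_or_nonempty with h | h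
    · refine ⟨⟨0, i.pos⟩, Or.inr ⟨hi, by simp [Fin.le_def], fun t ht hti => ?_, Or.inl rfl⟩⟩
      have : t ∈ T.filter (· < i) := Finset.mem_filter.2 ⟨ht, hti⟩
      simp [h] at this
    · have hm := Finset.max'_mem _ h
      have hle := fun t ht => Finset.le_max' (T.filter (· < i)) t ht
      set m := (T.filter (· < i)).max' h
      obtain ⟨hm1, hm2⟩ := Finset.mem_filter.1 hm
      refine ⟨⟨m + 1, by omega⟩, Or.inr ⟨hi, by rw [Fin.le_def]; exact hm2, fun t ht hti => ?_,
        Or.inr ⟨m, hm1, rfl⟩⟩⟩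
      have := hle t (Finset.mem_filter.2 ⟨ht, hti⟩)
      rw [Fin.lt_def]
      exact Nat.lt_succ_of_le this
  · have : i.val + 1 ≠ N := fun h => hi (hT i h)
    exact ⟨⟨i + 1, by omega⟩, Or.inl ⟨hi, rfl⟩⟩

theorem exists_least_ge {N : ℕ} {T : Finset (Fin N)}
    (hT : ∀ i : Fin N, i.val + 1 = N → i ∈ T) (i : Fin N) :
    ∃ b ∈ T, i ≤ b ∧ ∀ t ∈ T, i ≤ t → b ≤ t := by
  have hne : (T.filter (i ≤ ·)).Nonempty :=
    ⟨⟨N - 1, Nat.sub_one_lt_of_lt i.isLt⟩, Finset.mem_filter.2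
      ⟨hT _ (Nat.sub_add_cancel (i.pos)), Fin.le_def.2 (Nat.le_sub_one_of_lt i.isLt)⟩⟩
  obtain ⟨hm1, hm2⟩ := Finset.mem_filter.1 (Finset.min'_mem _ hne)
  exact ⟨_, hm1, hm2, fun t ht hit => Finset.min'_le _ _ (Finset.mem_filter.2 ⟨ht, hit⟩)⟩

/-! ### The map with the additional loop -/

namespace RootedMap

variable {n k : ℕ} (M : RootedMap n k)

theorem opp'_opp' (d : M.D') : M.opp' (M.opp' d) = d := by
  rcases d with d | b <;> simp [opp', M.opp_opp]

theorem opp'_ne (d : M.D') : M.opp' d ≠ d := by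
  rcases d with d | b <;> simp [opp', M.opp_ne]

theorem opp'_loopHead : M.opp' M.loopHead = M.loopTail := rfl

theorem opp'_loopTail : M.opp' M.loopTail = M.loopHead := rfl

theorem card_D' : Fintype.card M.D' = 2 * n + 2 := by
  simp [D', M.card_D]

theorem rot'_loopTail : M.rot' M.loopTail = M.loopHead := by
  classical
  unfold rot'
  cases h : M.root with
  | none => simp [loopTail, loopHead]
  | some r => simp [loopTail, loopHead, Equiv.swap_apply_of_ne_of_ne]

theorem rot'_loopHead_of_none (h : M.root = none) : M.rot' M.loopHead = M.loopTail := by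
  classical
  unfold rot'
  simp [h, loopTail, loopHead]

theorem rot'_loopHead_of_some {r : M.D} (h : M.root = some r) :
    M.rot' M.loopHead = Sum.inl r := by
  classical
  unfold rot'
  simp only [h]
  simp [loopTail, loopHead, Equiv.swap_apply_of_ne_of_ne]

theorem rot'_inl_of_eq {r x : M.D} (h : M.root = some r) (hx : M.rot x = r) :
    M.rot' (Sum.inl x) = M.loopTail := by
  classical
  unfold rot'
  simp only [h]
  simp [loopTail, loopHead, hx]

theorem rot'_inl_of_ne {r x : M.D} (h : M.root = some r) (hx : M.rot x ≠ r) :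
    M.rot' (Sum.inl x) = Sum.inl (M.rot x) := by
  classical
  unfold rot'
  simp only [h]
  simp [loopTail, loopHead, hx, Equiv.swap_apply_of_ne_of_ne]

theorem exists_root (d : M.D) : ∃ r, M.root = some r := by
  cases h : M.root with
  | none => exact ((M.isEmpty_of_root h).false d).elim
  | some r => exact ⟨r, rfl⟩

/-- The vertex that carries the additional loop. -/
noncomputable def baseVert : M.V :=
  match M.root with
  | none => Classical.arbitrary M.V
  | some r => M.vert r

theorem baseVert_of_some {r : M.D} (h : M.root = some r) : M.baseVert = M.vert r := by
  simp [baseVert, h]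

/-- The vertex with which a half-edge of the map with the additional loop is incident. -/
noncomputable def vert' : M.D' → M.V := Sum.elim M.vert fun _ => M.baseVert

theorem vert'_loopTail : M.vert' M.loopTail = M.baseVert := rfl

theorem vert'_rot' (x : M.D') : M.vert' (M.rot' x) = M.vert' x := by
  rcases x with x | b
  · obtain ⟨r, hr⟩ := M.exists_root x
    have hx : M.vert (M.rot x) = M.vert x :=
      (M.vert_eq_iff _ _).2 (Equiv.Perm.sameCycle_apply_left.2 (Equiv.Perm.SameCycle.refl _ _))
    by_cases h : M.rot x = r
    · rw [M.rot'_inl_of_eq hr h, vert'_loopTail, M.baseVert_of_some hr, ← h, hx]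
      rfl
    · rw [M.rot'_inl_of_ne hr h]
      exact hx
  · cases b with
    | false => exact (congrArg M.vert' M.rot'_loopTail).trans rfl
    | true =>
      cases h : M.root with
      | none => exact (congrArg M.vert' (M.rot'_loopHead_of_none h)).trans rfl
      | some r =>
        exact (congrArg M.vert' (M.rot'_loopHead_of_some h)).trans (M.baseVert_of_some h).symm

theorem vert'_eq_of_sameCycle {x y : M.D'} (h : M.rot'.SameCycle x y) :
    M.vert' x = M.vert' y := by
  obtain ⟨i, rfl⟩ := h.exists_nat_pow_eq
  induction i with
  | zero => rfl
  | succ i ih => rw [pow_succ', Equiv.Perm.mul_apply, vert'_rot', ← ih ⟨i, by simp⟩]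

/-- One step of `rot` is one step of `rot'`, except just before the root, where the loop is
inserted. -/
theorem sameCycle_rot'_inl {x y : M.D} (h : M.rot.SameCycle x y) :
    M.rot'.SameCycle (Sum.inl x) (Sum.inl y) := by
  obtain ⟨i, rfl⟩ := h.exists_nat_pow_eq
  clear h
  induction i with
  | zero => exact Equiv.Perm.SameCycle.refl _ _
  | succ i ih =>
    refine ih.trans ?_
    rw [pow_succ', Equiv.Perm.mul_apply]
    generalize (M.rot ^ i) x = z
    obtain ⟨r, hr⟩ := M.exists_root z
    by_cases hz : M.rot z = r
    -- The detour runs through the tail and the head of the loop before it reaches the root.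
    · refine ⟨3, ?_⟩
      have : M.rot' (M.rot' (M.rot' (Sum.inl z))) = Sum.inl (M.rot z) := by
        rw [M.rot'_inl_of_eq hr hz, rot'_loopTail, M.rot'_loopHead_of_some hr, hz]
      exact this
    · exact ⟨1, by simpa using M.rot'_inl_of_ne hr hz⟩

theorem sameCycle_inr_loopTail (b : Bool) : M.rot'.SameCycle (Sum.inr b) M.loopTail := by
  cases b with
  | false => exact Equiv.Perm.SameCycle.refl _ _
  | true =>
    change M.rot'.SameCycle M.loopHead M.loopTail
    rw [← rot'_loopTail]
    exact Equiv.Perm.sameCycle_apply_left.2 (Equiv.Perm.SameCycle.refl _ _)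

theorem sameCycle_inl_loopTail {x : M.D} (h : M.vert x = M.baseVert) :
    M.rot'.SameCycle (Sum.inl x) M.loopTail := by
  obtain ⟨r, hr⟩ := M.exists_root x
  rw [M.baseVert_of_some hr, M.vert_eq_iff] at h
  refine (M.sameCycle_rot'_inl h).trans ?_
  rw [← M.rot'_loopHead_of_some hr]
  exact Equiv.Perm.sameCycle_apply_left.2 (M.sameCycle_inr_loopTail true)

theorem vert'_eq_iff (x y : M.D') : M.vert' x = M.vert' y ↔ M.rot'.SameCycle x y := by
  refine ⟨fun h => ?_, M.vert'_eq_of_sameCycle⟩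
  rcases x with x | b <;> rcases y with y | c
  · exact M.sameCycle_rot'_inl ((M.vert_eq_iff _ _).1 h)
  · exact (M.sameCycle_inl_loopTail h).trans (M.sameCycle_inr_loopTail c).symm
  · exact (M.sameCycle_inr_loopTail b).trans (M.sameCycle_inl_loopTail h.symm).symm
  · exact (M.sameCycle_inr_loopTail b).trans (M.sameCycle_inr_loopTail c).symm

/-- Connectedness of the graph in terms of half-edges: a walk from the vertex of the loop never
leaves the vertices met by `S`. -/
theorem exists_vert'_eq_of_closed {S : Set M.D'} (h0 : M.loopTail ∈ S)
    (hv : ∀ x ∈ S, ∀ y, M.vert' x = M.vert' y → y ∈ S) (ho : ∀ x ∈ S, M.opp' x ∈ S) (v : M.V) :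
    ∃ x ∈ S, M.vert' x = v := by
  induction M.connected M.baseVert v with
  | refl => exact ⟨_, h0, rfl⟩
  | tail _ h ih =>
    obtain ⟨d, rfl, rfl⟩ := h
    obtain ⟨x, hx, hxd⟩ := ih
    exact ⟨_, ho _ (hv x hx (Sum.inl d) hxd), rfl⟩

theorem vert'_surjective : Function.Surjective M.vert' := fun v =>
  let ⟨x, _, hx⟩ := M.exists_vert'_eq_of_closed (S := Set.univ) trivial
    (fun _ _ _ _ => trivial) (fun _ _ => trivial) v
  ⟨x, hx⟩

/-- A set of half-edges closed under all the operations contains all of them. -/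
theorem mem_of_closed {S : Set M.D'} (h0 : M.loopTail ∈ S)
    (hv : ∀ x ∈ S, ∀ y, M.vert' x = M.vert' y → y ∈ S) (ho : ∀ x ∈ S, M.opp' x ∈ S) (y : M.D') :
    y ∈ S := by
  obtain ⟨x, hx, hxy⟩ := M.exists_vert'_eq_of_closed h0 hv ho (M.vert' y)
  exact hv x hx y hxy

theorem weight_eq : M.weight = Polynomial.X ^ (k - 1) := by
  classical
  unfold weight
  cases h : M.root with
  | none =>
    -- Without edges only the two ends of the loop remain. They share a vertex, and every vertex
    -- carries a half-edge.
    have hk : k = 1 := by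
      rw [← M.card_V, Fintype.card_eq_one_iff]
      refine ⟨M.baseVert, fun v => ?_⟩
      obtain ⟨x, rfl⟩ := M.vert'_surjective v
      rcases x with x | b
      · exact ((M.isEmpty_of_root h).false x).elim
      · rfl
    simp [hk]
  | some r =>
    simp only [Option.mem_def, Option.some.injEq, forall_eq']
    rw [Finset.prod_ite, Finset.prod_const_one, one_mul, Finset.prod_const]
    have hk : k - 1 = (Finset.univ.erase (M.vert r)).card := by
      rw [Finset.card_erase_of_mem (Finset.mem_univ _), Finset.card_univ, M.card_V]
    rw [hk]
    congr 2
    ext v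
    simp [eq_comm]

end RootedMap

/-! ### The exploration of the map -/

namespace RootedMap

variable {n k : ℕ} (M : RootedMap n k)

theorem minimalPeriod_rot'_pos (e : M.D') : 0 < Function.minimalPeriod M.rot' e :=
  Function.minimalPeriod_pos_of_mem_periodicPts
    (Function.Injective.mem_periodicPts M.rot'.injective e)

theorem length_around (e : M.D') :
    (M.around e).length = Function.minimalPeriod M.rot' e := by
  simp [around]

theorem around_getElem? {e : M.D'} {i : ℕ} (hi : i < (M.around e).length) :
    (M.around e)[i]? = some (M.rot'^[i + 1] e) := by
  rw [length_around] at hi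
  simp [around, hi]

theorem nodup_around (e : M.D') : (M.around e).Nodup := by
  unfold around
  refine List.Nodup.map_on (fun i hi j hj h => ?_) List.nodup_range
  rw [Function.iterate_succ_apply', Function.iterate_succ_apply', M.rot'.injective.eq_iff] at h
  exact Function.iterate_injOn_Iio_minimalPeriod (List.mem_range.1 hi) (List.mem_range.1 hj) h

theorem mem_around {e x : M.D'} : x ∈ M.around e ↔ M.vert' x = M.vert' e := by
  have hmem : x ∈ M.around e ↔
      ∃ i < Function.minimalPeriod M.rot' e, M.rot'^[i + 1] e = x := by
    simp [around, eq_comm]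
  rw [hmem]
  constructor
  · rintro ⟨i, -, hi⟩
    rw [← hi]
    generalize i + 1 = j
    induction j with
    | zero => rfl
    | succ j ih => rw [Function.iterate_succ_apply', vert'_rot', ih]
  · intro h
    -- `around` starts one step after `e`, so the index of `x` is the number of steps from `e` to
    -- the predecessor of `x`.
    have h1 : M.rot'.SameCycle e (M.rot'.symm x) := by
      rw [← vert'_eq_iff, ← h, ← M.vert'_rot' (M.rot'.symm x), Equiv.apply_symm_apply]
    obtain ⟨i, hi⟩ := h1.exists_nat_pow_eq
    refine ⟨i % Function.minimalPeriod M.rot' e, Nat.mod_lt _ (M.minimalPeriod_rot'_pos e), ?_⟩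
    rw [Function.iterate_succ_apply', Function.iterate_mod_minimalPeriod_eq,
      ← Equiv.Perm.coe_pow, hi, Equiv.apply_symm_apply]

open Classical in
/-- The properties of a list `w` of half-edges obtained by the exploration, where `T` is the set
of positions at which the block of a vertex ends. -/
structure Explored (w : List M.D') (T : Finset ℕ) : Prop where
  nodup : w.Nodup
  closed : ∀ x ∈ w, ∀ y, M.vert' x = M.vert' y → y ∈ w
  lt : ∀ t ∈ T, t < w.length
  last : w.length = 0 ∨ ∃ t ∈ T, t + 1 = w.length
  succ : ∀ i x, i ∉ T → w[i]? = some x → w[i + 1]? = some (M.rot' x)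
  ends : ∀ i x, i ∈ T → w[i]? = some x → ∃ s ≤ i, w[s]? = some (M.rot' x) ∧
    (∀ t ∈ T, t < i → t < s) ∧ (s = 0 ∨ ∃ t ∈ T, t + 1 = s) ∧
    (M.opp' x = M.loopHead ∨ ∃ a < s, w[a]? = some (M.opp' x) ∧
      ∀ a' < a, ∀ y, w[a']? = some y → ∃ b < s, w[b]? = some (M.opp' y))
  card : (w.map M.vert').toFinset.card = T.card

theorem explored_nil : M.Explored [] ∅ := by
  constructor <;> simp

variable {M}

/-- The hypothesis `hopp` says that `e` is opposite to the leftmost unattached half-edge. The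
alternative `M.loopHead` serves the first block, for which nothing has been listed yet. -/
theorem Explored.append_around {w : List M.D'} {T : Finset ℕ} (h : M.Explored w T) {e : M.D'}
    (he : e ∉ w) (hopp : M.opp' e = M.loopHead ∨ ∃ a : ℕ, w[a]? = some (M.opp' e) ∧
      ∀ a' < a, ∀ y, w[a']? = some y → M.opp' y ∈ w) :
    ∃ T', M.Explored (w ++ M.around e) T' ∧ T'.card = T.card + 1 := by
  classical
  have hp : 0 < (M.around e).length := by
    rw [length_around]
    exact M.minimalPeriod_rot'_pos e
  have hper : M.rot'^[(M.around e).length] e = e := by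
    rw [length_around]
    exact Function.iterate_minimalPeriod
  have hge : ∀ i, i < (M.around e).length →
      (w ++ M.around e)[w.length + i]? = some (M.rot'^[i + 1] e) := by
    intro i hi
    rw [List.getElem?_append_right (by omega), Nat.add_sub_cancel_left, M.around_getElem? hi]
  have hlt : ∀ (i : ℕ) x, w[i]? = some x → i < w.length := by
    intro i x hx
    exact (List.getElem?_eq_some_iff.1 hx).1
  have hl : ∀ (i : ℕ) x, w[i]? = some x → (w ++ M.around e)[i]? = some x := by
    intro i x hx
    rw [List.getElem?_append_left (hlt i x hx), hx]
  have hcase : ∀ (i : ℕ) x, (w ++ M.around e)[i]? = some x → w[i]? = some x ∨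
      ∃ j < (M.around e).length, i = w.length + j ∧ x = M.rot'^[j + 1] e := by
    intro i x hx
    by_cases hi : i < w.length
    · left
      rwa [List.getElem?_append_left hi] at hx
    · right
      have hi2 := (List.getElem?_eq_some_iff.1 hx).1
      rw [List.length_append] at hi2
      have h3 := hge (i - w.length) (by omega)
      rw [Nat.add_sub_cancel' (by omega), hx] at h3
      exact ⟨i - w.length, by omega, by omega, Option.some.inj h3⟩
  -- The position of `e` itself, the last entry of the new block.
  set q := w.length + ((M.around e).length - 1) with hq
  have hqT : q ∉ T := fun hqT => by
    have := h.lt q hqT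
    omega
  refine ⟨insert q T, ⟨?_, ?_, ?_, ?_, ?_, ?_, ?_⟩, Finset.card_insert_of_notMem hqT⟩
  · refine List.Nodup.append h.nodup (M.nodup_around e) fun x hx hx' => he ?_
    exact h.closed x hx e (M.mem_around.1 hx')
  · intro x hx y hxy
    rw [List.mem_append] at hx ⊢
    rcases hx with hx | hx
    · exact Or.inl (h.closed x hx y hxy)
    · rw [M.mem_around] at hx ⊢
      exact Or.inr (hxy.symm.trans hx)
  · intro t ht
    rw [List.length_append]
    rcases Finset.mem_insert.1 ht with rfl | ht
    · omega
    · have := h.lt t ht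
      omega
  · exact Or.inr ⟨q, Finset.mem_insert_self _ _, by rw [List.length_append]; omega⟩
  · intro i x hi hx
    rw [Finset.mem_insert, not_or] at hi
    rcases hcase i x hx with hx | ⟨j, hj, rfl, rfl⟩
    · exact hl _ _ (h.succ i x hi.2 hx)
    · rw [← Function.iterate_succ_apply' (f := M.rot'), add_assoc]
      exact hge (j + 1) (by omega)
  · intro i x hi hx
    rcases hcase i x hx with hx | ⟨j, hj, rfl, rfl⟩
    · have hi' : i ∈ T := (Finset.mem_insert.1 hi).resolve_left fun h1 => by
        have := hlt i x hx
        omega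
      obtain ⟨s, hsi, hs, hT, h0, hop⟩ := h.ends i x hi' hx
      refine ⟨s, hsi, hl _ _ hs, ?_, ?_, ?_⟩
      · intro t ht hti
        rcases Finset.mem_insert.1 ht with rfl | ht
        · have := hlt i x hx
          omega
        · exact hT t ht hti
      · rcases h0 with h0 | ⟨t, ht, h0⟩
        · exact Or.inl h0
        · exact Or.inr ⟨t, Finset.mem_insert_of_mem ht, h0⟩
      · rcases hop with hop | ⟨a, has, ha, hop⟩
        · exact Or.inl hop
        · refine Or.inr ⟨a, has, hl _ _ ha, fun a' ha' y hy => ?_⟩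
          have hlen := hlt a _ ha
          rw [List.getElem?_append_left (by omega)] at hy
          obtain ⟨b, hb, hb'⟩ := hop a' ha' y hy
          exact ⟨b, hb, hl _ _ hb'⟩
    · have hj' : j + 1 = (M.around e).length := by
        rcases Finset.mem_insert.1 hi with h1 | h1
        · omega
        · have := h.lt _ h1
          omega
      rw [hj', hper]
      refine ⟨w.length, by omega, hge 0 hp, ?_, ?_, ?_⟩
      · intro t ht htj
        rcases Finset.mem_insert.1 ht with rfl | ht
        · omega
        · exact h.lt t ht
      · rcases h.last with h0 | ⟨t, ht, h0⟩
        · exact Or.inl h0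
        · exact Or.inr ⟨t, Finset.mem_insert_of_mem ht, h0⟩
      · refine hopp.imp_right ?_
        rintro ⟨a, ha, hop⟩
        refine ⟨a, hlt _ _ ha, hl _ _ ha, fun a' ha' y hy => ?_⟩
        have hlen := hlt a _ ha
        rw [List.getElem?_append_left (by omega)] at hy
        obtain ⟨b, hb, hb'⟩ := List.mem_iff_getElem.1 (hop a' ha' y hy)
        refine ⟨b, hb, hl _ _ ?_⟩
        rw [List.getElem?_eq_getElem hb, hb']
  · rw [Finset.card_insert_of_notMem hqT, ← h.card]
    have : ((w ++ M.around e).map M.vert').toFinset =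
        insert (M.vert' e) (w.map M.vert').toFinset := by
      ext v
      simp only [List.map_append, List.toFinset_append, Finset.mem_union, List.mem_toFinset,
        List.mem_map, Finset.mem_insert, M.mem_around]
      constructor
      · rintro (h1 | ⟨x, hx, rfl⟩)
        · exact Or.inr h1
        · exact Or.inl hx
      · rintro (rfl | h1)
        · exact Or.inr ⟨e, rfl, rfl⟩
        · exact Or.inl h1
    rw [this, Finset.card_insert_of_notMem]
    simp only [List.mem_toFinset, List.mem_map, not_exists, not_and]
    exact fun x hx hxe => he (h.closed x hx e hxe)

variable (M)

/-- The first half-edge in the list whose opposite is not in the list, if any. -/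
theorem step_cases (w : List M.D') : ((∀ x ∈ w, M.opp' x ∈ w) ∧ M.step w = w) ∨
    ∃ (a : ℕ) (d : M.D'), w[a]? = some d ∧ M.opp' d ∉ w ∧
      (∀ a' < a, ∀ y, w[a']? = some y → M.opp' y ∈ w) ∧
      M.step w = w ++ M.around (M.opp' d) := by
  classical
  unfold step
  split
  · rename_i h
    left
    rw [List.find?_eq_none] at h
    exact ⟨fun x hx => by simpa using h x hx, rfl⟩
  · rename_i d h
    right
    obtain ⟨hd, u, v, huv, hu⟩ := List.find?_eq_some_iff_append.1 h
    refine ⟨u.length, d, by rw [huv]; simp, by simpa using hd, fun a' ha' y hy => ?_, rfl⟩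
    have hy' : y ∈ u := by
      conv at hy => lhs; rw [huv]
      rw [List.getElem?_append_left ha'] at hy
      exact List.mem_of_getElem? hy
    simpa using hu y hy'

/-- The number of blocks measures progress: each step adds one unless the list is already closed
under opposites. -/
theorem exists_explored_iterate (j : ℕ) : ∃ T, M.Explored (M.step^[j] (M.around M.loopTail)) T ∧
    (M.step^[j] (M.around M.loopTail))[0]? = some M.loopHead ∧
    ((∀ x ∈ M.step^[j] (M.around M.loopTail), M.opp' x ∈ M.step^[j] (M.around M.loopTail)) ∨
      j + 1 ≤ T.card) := by
  induction j with
  | zero =>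
    obtain ⟨T, hT, hc⟩ := M.explored_nil.append_around (e := M.loopTail) (by simp)
      (Or.inl M.opp'_loopTail)
    rw [List.nil_append] at hT
    refine ⟨T, hT, ?_, Or.inr (by simp [hc])⟩
    have hp : 0 < (M.around M.loopTail).length := by
      rw [length_around]
      exact M.minimalPeriod_rot'_pos _
    rw [Function.iterate_zero_apply, M.around_getElem? hp]
    exact congrArg some M.rot'_loopTail
  | succ j ih =>
    obtain ⟨T, hT, h0, hc⟩ := ih
    rw [Function.iterate_succ_apply']
    set w := M.step^[j] (M.around M.loopTail)
    rcases M.step_cases w with ⟨hw, hs⟩ | ⟨a, d, ha, hd, hlt, hs⟩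
    · rw [hs]
      exact ⟨T, hT, h0, Or.inl hw⟩
    · rw [hs]
      obtain ⟨T', hT', hc'⟩ := hT.append_around hd (Or.inr ⟨a, by rw [opp'_opp']; exact ha, hlt⟩)
      refine ⟨T', hT', ?_, Or.inr ?_⟩
      · rw [List.getElem?_append_left (List.getElem?_eq_some_iff.1 h0).1, h0]
      · rw [hc']
        rcases hc with hc | hc
        · exact absurd (hc d (List.mem_of_getElem? ha)) hd
        · omega

theorem exists_explored_visits : ∃ T, M.Explored M.visits T ∧
    M.visits[0]? = some M.loopHead ∧ (∀ x, x ∈ M.visits) ∧ T.card = k := by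
  classical
  obtain ⟨T, hT, h0, hc⟩ := M.exists_explored_iterate k
  change M.Explored M.visits T at hT
  change M.visits[0]? = _ at h0
  change (∀ x ∈ M.visits, M.opp' x ∈ M.visits) ∨ _ at hc
  have hcard : T.card ≤ k := by
    rw [← hT.card]
    exact (Finset.card_le_univ _).trans_eq M.card_V
  -- After `k` steps the other alternative would give `k + 1` blocks, but blocks belong to different
  -- vertices.
  have hopp : ∀ x ∈ M.visits, M.opp' x ∈ M.visits := hc.resolve_right (by omega)
  have htail : M.loopTail ∈ M.visits :=
    hopp _ (List.mem_of_getElem? h0)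
  have hall : ∀ x, x ∈ M.visits := fun x =>
    M.mem_of_closed (S := {x | x ∈ M.visits}) htail hT.closed hopp x
  refine ⟨T, hT, h0, hall, ?_⟩
  rw [← hT.card]
  refine Eq.trans ?_ (Finset.card_univ.trans M.card_V)
  congr 1
  ext v
  obtain ⟨x, rfl⟩ := M.vert'_surjective v
  simp only [List.mem_toFinset, List.mem_map, Finset.mem_univ, iff_true]
  exact ⟨x, hall x, rfl⟩

end RootedMap

/-! ### The labelling of the half-edges by their positions -/

namespace RootedMap

variable {n k : ℕ}

/-- The bijection `e` labels the half-edges by their positions in the list of visits, and `ι` is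
the corresponding matching. -/
structure IsLabelling (M : RootedMap n k) (ι : Fin (2 * n + 2) → Fin (2 * n + 2))
    (e : Fin (2 * n + 2) ≃ M.D') : Prop where
  zero : e 0 = M.loopHead
  opp : ∀ i, M.opp' (e i) = e (ι i)
  matching : IsMatchingOf M.toMatching ι
  rot : ∀ i s, IsBlockSucc (rightEnds ι) i s → M.rot' (e i) = e s
  last : ∀ i : Fin (2 * n + 2), i.val + 1 = 2 * n + 2 → i ∈ rightEnds ι
  card : (rightEnds ι).card = k
  connected : IsConnectedMatching M.toMatching

theorem isMatchingOf_toMatching {M : RootedMap n k} {e : Fin (2 * n + 2) ≃ M.D'}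
    {ι : Fin (2 * n + 2) → Fin (2 * n + 2)} (he : ∀ i, M.visits[i.val]? = some (e i))
    (hι : ∀ i, M.opp' (e i) = e (ι i)) : IsMatchingOf M.toMatching ι where
  invol p := e.injective (by rw [← hι, ← hι, opp'_opp'])
  ne p hp := M.opp'_ne (e p) (by rw [hι, hp])
  mem_iff p q := by
    classical
    simp only [toMatching, Finset.mem_filter, Finset.mem_univ, true_and, he, Option.some.injEq]
    refine and_congr_right fun _ => ⟨?_, ?_⟩
    · rintro ⟨d, rfl, h⟩
      rw [hι] at h
      exact (e.injective h).symm
    · rintro rfl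
      exact ⟨_, rfl, (hι p).symm⟩

/-- The block ends, known only through the exploration, are identified with `rightEnds ι`, which
depends on the matching alone. This makes the rotation readable from the matching. -/
theorem exists_isLabelling (M : RootedMap n k) : ∃ ι e, M.IsLabelling ι e := by
  classical
  obtain ⟨T, hT, h0, hall, hcard⟩ := M.exists_explored_visits
  have hlen : M.visits.length = 2 * n + 2 := by
    rw [← M.card_D', ← Fintype.card_fin M.visits.length]
    exact Fintype.card_congr (List.Nodup.getEquivOfForallMemList M.visits hT.nodup hall)
  obtain ⟨e, he⟩ : ∃ e : Fin (2 * n + 2) ≃ M.D', ∀ i, M.visits[i.val]? = some (e i) :=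
    ⟨(finCongr hlen.symm).trans (List.Nodup.getEquivOfForallMemList M.visits hT.nodup hall),
      fun i => by simp [hlen]⟩
  obtain ⟨ι, hι⟩ : ∃ ι : Fin (2 * n + 2) → Fin (2 * n + 2), ∀ i, M.opp' (e i) = e (ι i) :=
    ⟨fun i => e.symm (M.opp' (e i)), fun i => by simp⟩
  have hm := isMatchingOf_toMatching he hι
  have he0 : e 0 = M.loopHead := by
    have := he 0
    rw [Fin.val_zero, h0] at this
    exact (Option.some.inj this).symm
  have hpos : ∀ (a : ℕ) i, M.visits[a]? = some (e i) → a = i.val := by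
    intro a i ha
    have hlt := (List.getElem?_eq_some_iff.1 ha).1
    have := he ⟨a, by omega⟩
    rw [ha, Option.some.injEq, e.injective.eq_iff] at this
    rw [this]
  set S : Finset (Fin (2 * n + 2)) := Finset.univ.filter fun i => i.val ∈ T with hS
  have memS : ∀ i, i ∈ S ↔ i.val ∈ T := fun i => by simp [hS]
  have hlast : ∀ i : Fin (2 * n + 2), i.val + 1 = 2 * n + 2 → i ∈ S := by
    intro i hi
    rcases hT.last with h | ⟨t, ht, h⟩
    · omega
    · rw [memS, show i.val = t by omega]
      exact ht
  have hsucc : ∀ i ∉ S, ∃ s : Fin (2 * n + 2), s.val = i.val + 1 ∧ M.rot' (e i) = e s := by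
    intro i hi
    rw [memS] at hi
    have h1 := hT.succ _ _ hi (he i)
    have h2 := (List.getElem?_eq_some_iff.1 h1).1
    rw [he ⟨i.val + 1, by omega⟩, Option.some.injEq] at h1
    exact ⟨_, rfl, h1.symm⟩
  have hends : ∀ i ∈ S, ∃ s ≤ i, M.rot' (e i) = e s ∧ (∀ t ∈ S, t < i → t < s) ∧
      (s.val = 0 ∨ ∃ t ∈ S, t.val + 1 = s.val) ∧
      (ι i = 0 ∨ ι i < s ∧ ∀ a < ι i, ι a < s) := by
    intro i hi
    obtain ⟨s, hsi, h1, h2, h3, h4⟩ := hT.ends _ _ ((memS i).1 hi) (he i)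
    have hs2 := (List.getElem?_eq_some_iff.1 h1).1
    refine ⟨⟨s, by omega⟩, hsi, ?_, fun t ht hti => h2 t ((memS t).1 ht) hti, ?_, ?_⟩
    · rw [he ⟨s, by omega⟩, Option.some.injEq] at h1
      exact h1.symm
    · refine h3.imp_right ?_
      rintro ⟨t, ht, h⟩
      have := hT.lt t ht
      exact ⟨⟨t, by omega⟩, (memS _).2 ht, h⟩
    · rw [hι, ← he0, e.injective.eq_iff] at h4
      refine h4.imp_right ?_
      rintro ⟨a, has, ha, h5⟩
      obtain rfl := hpos _ _ ha
      refine ⟨has, fun a ha => ?_⟩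
      obtain ⟨b, hb, hb'⟩ := h5 a ha _ (he a)
      rw [hι] at hb'
      obtain rfl := hpos _ _ hb'
      exact hb
  -- Here `i` is the end of the block of `b`. Its partner is 0 or lies before the block; points left
  -- of that partner are matched before the block, so none of them is matched to `b`.
  have hnest : ∀ b ∉ S, ∃ i, b < i ∧ (b ≠ 0 → ι i < b) ∧ (ι b < b → ι i < ι b) := by
    intro b hb
    obtain ⟨i, hi, hbi, hmin⟩ := exists_least_ge hlast b
    obtain ⟨s, hsi, -, -, h3, h4⟩ := hends i hi
    have hlt : b < i := lt_of_le_of_ne hbi fun h => hb (h ▸ hi)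
    have hsb : s ≤ b := by
      rcases h3 with h3 | ⟨t, ht, h3⟩
      · omega
      · by_contra! h
        have := hmin t ht (by omega)
        omega
    refine ⟨i, hlt, fun h => ?_, fun h => ?_⟩
    · rcases h4 with h4 | ⟨h4, -⟩
      · rw [h4]
        exact Fin.pos_iff_ne_zero.2 h
      · omega
    · rcases h4 with h4 | ⟨h4, h5⟩
      · rw [h4, Fin.pos_iff_ne_zero]
        intro h6
        exact hlt.ne (hm.injective (h6.trans h4.symm))
      · by_contra! h6
        rcases h6.lt_or_eq with h6 | h6
        · have := h5 _ h6
          rw [hm.invol] at this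
          omega
        · exact hlt.ne (hm.injective h6)
  have hST : S = rightEnds ι := by
    ext b
    rw [mem_rightEnds]
    refine ⟨fun hb => ?_, fun ⟨h1, h2⟩ => ?_⟩
    · obtain ⟨s, hsi, -, -, -, h4⟩ := hends b hb
      rcases h4 with h4 | ⟨h4, h5⟩
      · rw [h4]
        refine ⟨?_, fun a ha => absurd ha (Fin.not_lt_zero a)⟩
        rw [Fin.pos_iff_ne_zero]
        intro h
        exact hm.ne b (h4.trans h.symm)
      · exact ⟨by omega, fun a ha => by have := h5 a ha; omega⟩
    · by_contra hb
      obtain ⟨i, h3, -, h4⟩ := hnest b hb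
      have := h2 _ (h4 h1)
      rw [hm.invol] at this
      omega
  have hSrot : ∀ i s, IsBlockSucc S i s → M.rot' (e i) = e s := by
    intro i s his
    by_cases hi : i ∈ S
    · obtain ⟨s', h1, h2, h3, h4, -⟩ := hends i hi
      rw [h2, his.unique (Or.inr ⟨hi, h1, h3, h4⟩)]
    · obtain ⟨s', h1, h2⟩ := hsucc i hi
      rw [h2, his.unique (Or.inl ⟨hi, h1⟩)]
  refine ⟨ι, e, he0, hι, hm, hST ▸ hSrot, hST ▸ hlast, ?_, ?_⟩
  · rw [← hST, ← hcard]
    refine Finset.card_bij (fun i _ => i.val) (fun i hi => (memS i).1 hi)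
      (fun i _ j _ h => Fin.ext h) fun t ht => ?_
    have := hT.lt t ht
    exact ⟨⟨t, by omega⟩, (memS _).2 ht, rfl⟩
  · rw [hm.isConnectedMatching_iff]
    intro v hv0 hv1
    have hv0' : v ≠ 0 := fun h => hv0 (by simp [h])
    by_cases hv : v ∈ S
    -- A block end `v` is covered by the edge that ends the next block: its left end is 0 or at most
    -- `v`, and it is not `v`, which is itself a right end.
    · obtain ⟨i, hi, hbi, hmin⟩ := exists_least_ge hlast ⟨v.val + 1, by omega⟩
      rw [Fin.le_def] at hbi
      simp only at hbi
      obtain ⟨s, hsi, -, h2, h3, h4⟩ := hends i hi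
      have hvs := h2 v hv (by omega)
      have hsv : s.val ≤ v.val + 1 := by
        by_contra! h
        rcases h3 with h3 | ⟨t, ht, h3⟩
        · omega
        · have := hmin t ht (by rw [Fin.le_def]; simp only; omega)
          omega
      refine ⟨ι i, ?_, by rw [hm.invol]; omega⟩
      rcases h4 with h4 | ⟨h4, -⟩
      · rw [h4]
        exact Fin.pos_iff_ne_zero.2 hv0'
      · refine lt_of_le_of_ne (by omega) fun h => ?_
        have h5 := (mem_rightEnds.1 (hST ▸ hv)).1
        rw [← h, hm.invol] at h5
        omega
    · obtain ⟨i, h3, h4, -⟩ := hnest v hv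
      exact ⟨ι i, h4 hv0', by rwa [hm.invol]⟩

theorem IsLabelling.matchingWeight_eq {M : RootedMap n k} {ι : Fin (2 * n + 2) → Fin (2 * n + 2)}
    {e : Fin (2 * n + 2) ≃ M.D'} (h : M.IsLabelling ι e) :
    matchingWeight M.toMatching = Polynomial.X ^ (k - 1) := by
  rw [h.matching.matchingWeight_eq, h.card]

end RootedMap

/-! ### A map is determined by its matching -/

namespace RootedMap

variable {n k : ℕ} {M M' : RootedMap n k}

/-- This expresses `rot` through `rot'`, so that a bijection commuting with `rot'` also commutes
with `rot`. -/
theorem rot_eq_iff {r x y : M.D} (h : M.root = some r) : M.rot x = y ↔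
    (y ≠ r ∧ M.rot' (Sum.inl x) = Sum.inl y) ∨ (y = r ∧ M.rot' (Sum.inl x) = M.loopTail) := by
  by_cases hx : M.rot x = r
  · rw [M.rot'_inl_of_eq h hx, hx]
    simp [loopTail, eq_comm]
  · rw [M.rot'_inl_of_ne h hx]
    simp only [Sum.inl.injEq, loopTail, reduceCtorEq, and_false, or_false]
    constructor
    · rintro rfl
      exact ⟨hx, rfl⟩
    · exact And.right

/-- An isomorphism of the maps with the additional loops restricts to the original maps. -/
theorem nonempty_iso (g : M.D' ≃ M'.D') (hopp : ∀ x, g (M.opp' x) = M'.opp' (g x))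
    (hrot : ∀ x, g (M.rot' x) = M'.rot' (g x)) (hhead : g M.loopHead = M'.loopHead) :
    Nonempty (Iso M M') := by
  have htail : g M.loopTail = M'.loopTail := by
    rw [← opp'_loopHead, hopp, hhead, opp'_loopHead]
  have hinr : ∀ b, g (Sum.inr b) = Sum.inr b := by
    rintro (_ | _)
    · exact htail
    · exact hhead
  have hinl : ∀ x : M.D, ∃ y, g (Sum.inl x) = Sum.inl y := by
    intro x
    rcases h : g (Sum.inl x) with y | b
    · exact ⟨y, rfl⟩
    · rw [← hinr b] at h
      exact absurd (g.injective h) (by simp)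
  choose f hf using hinl
  have hbij : Function.Bijective f := by
    refine ⟨fun x y h => ?_, fun y => ?_⟩
    · have := hf x
      rw [h, ← hf y] at this
      exact Sum.inl_injective (g.injective this)
    · rcases h : g.symm (Sum.inl y) with x | b
      · rw [Equiv.symm_apply_eq, hf] at h
        exact ⟨x, (Sum.inl_injective h).symm⟩
      · rw [Equiv.symm_apply_eq, hinr] at h
        exact absurd h (by simp)
  have hroot : M.root.map f = M'.root := by
    cases h : M.root with
    | none =>
      cases h' : M'.root with
      | none => rfl
      | some r =>
        have := hrot M.loopHead
        rw [M.rot'_loopHead_of_none h, htail, hhead, M'.rot'_loopHead_of_some h'] at this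
        exact absurd this (by simp [loopTail])
    | some r =>
      have := hrot M.loopHead
      rw [M.rot'_loopHead_of_some h, hhead, hf] at this
      cases h' : M'.root with
      | none =>
        rw [M'.rot'_loopHead_of_none h'] at this
        exact absurd this (by simp [loopTail])
      | some r' =>
        rw [M'.rot'_loopHead_of_some h'] at this
        exact congrArg some (Sum.inl_injective this)
  have hrot₀ : ∀ d, f (M.rot d) = M'.rot (f d) := by
    intro d
    obtain ⟨r, hr⟩ := M.exists_root d
    have hr' : M'.root = some (f r) := by rw [← hroot, hr]; rfl
    symm
    rw [rot_eq_iff hr', ← hf, ← hrot, hbij.injective.ne_iff, hbij.injective.eq_iff, ← hf,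
      g.injective.eq_iff, ← htail, g.injective.eq_iff, ← rot_eq_iff hr]
  have hsame : ∀ x y, M.vert' x = M.vert' y ↔ M'.vert' (g x) = M'.vert' (g y) := by
    have hpow : ∀ (i : ℕ) x, g ((M.rot' ^ i) x) = (M'.rot' ^ i) (g x) := by
      intro i x
      rw [Equiv.Perm.coe_pow, Equiv.Perm.coe_pow]
      exact (Function.Semiconj.iterate_right (f := g) hrot i) x
    intro x y
    rw [vert'_eq_iff, vert'_eq_iff]
    constructor
    · intro h
      obtain ⟨i, rfl⟩ := h.exists_nat_pow_eq
      exact ⟨i, by simp [hpow]⟩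
    · intro h
      obtain ⟨i, hi⟩ := h.exists_nat_pow_eq
      rw [← hpow, g.injective.eq_iff] at hi
      exact ⟨i, by simpa using hi⟩
  choose x hx using M.vert'_surjective
  have hV : ∀ z, M'.vert' (g (x (M.vert' z))) = M'.vert' (g z) := fun z =>
    (hsame _ _).1 (hx _)
  have hVbij : Function.Bijective fun v => M'.vert' (g (x v)) := by
    refine ⟨fun v w h => ?_, fun v => ?_⟩
    · rw [← hx v, ← hx w]
      exact (hsame _ _).2 h
    · obtain ⟨y, rfl⟩ := M'.vert'_surjective v
      exact ⟨M.vert' (g.symm y), by simp only [hV, Equiv.apply_symm_apply]⟩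
  refine ⟨⟨Equiv.ofBijective f hbij, Equiv.ofBijective _ hVbij, fun d => ?_, hrot₀, fun d => ?_,
    hroot⟩⟩
  · have := hopp (Sum.inl d)
    rw [hf] at this
    change g (Sum.inl (M.opp d)) = Sum.inl (M'.opp (f d)) at this
    rw [hf] at this
    exact Sum.inl_injective this
  · have := hV (Sum.inl d)
    rw [hf] at this
    exact this

theorem nonempty_iso_of_toMatching_eq (h : M.toMatching = M'.toMatching) :
    Nonempty (Iso M M') := by
  obtain ⟨ι, e, he⟩ := M.exists_isLabelling
  obtain ⟨ι', e', he'⟩ := M'.exists_isLabelling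
  obtain rfl : ι = ι' := by
    have h1 := he.matching
    have h2 := he'.matching
    rw [← h] at h2
    funext p
    rcases lt_or_gt_of_ne (h1.ne p) with hp | hp
    · have := ((h2.mem_iff _ _).1 ((h1.mem_iff (ι p) p).2 ⟨hp, h1.invol p⟩)).2
      rw [← this, h2.invol, this]
    · exact ((h2.mem_iff _ _).1 ((h1.mem_iff p (ι p)).2 ⟨hp, rfl⟩)).2.symm
  refine nonempty_iso (e.symm.trans e') (fun x => ?_) (fun x => ?_) ?_
  · obtain ⟨i, rfl⟩ := e.surjective x
    simp [he.opp, he'.opp]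
  · obtain ⟨i, rfl⟩ := e.surjective x
    obtain ⟨s, hs⟩ := exists_isBlockSucc he.last i
    simp [he.rot i s hs, he'.rot i s hs]
  · simp [← he.zero, ← he'.zero]

end RootedMap

/-! ### Connected matchings -/

namespace IsMatchingOf

variable {N : ℕ} {E : Finset (Fin N × Fin N)} {ι : Fin N → Fin N}

theorem ext {E' : Finset (Fin N × Fin N)} (h : IsMatchingOf E ι) (h' : IsMatchingOf E' ι) :
    E = E' := by
  ext ⟨p, q⟩
  rw [h.mem_iff, h'.mem_iff]

theorem last_mem_rightEnds (h : IsMatchingOf E ι) (i : Fin N) (hi : i.val + 1 = N) :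
    i ∈ rightEnds ι := by
  have key : ∀ a, ι a ≠ i → ι a < i := fun a ha => by omega
  rw [mem_rightEnds]
  refine ⟨key i (h.ne i), fun a ha => key a fun h1 => ?_⟩
  rw [← h1, h.invol] at ha
  exact lt_irrefl _ ha

/-- Every edge is nonnested or nested by a nonnested edge. -/
theorem exists_rightEnd_ge (h : IsMatchingOf E ι) {a : Fin N} (ha : a < ι a) :
    ∃ q ∈ rightEnds ι, ι a ≤ q ∧ ι q ≤ a := by
  -- Among the points up to `a`, the one with the rightmost partner starts a nonnested edge.
  obtain ⟨x, hx, hmax⟩ := Finset.exists_max_image (Finset.univ.filter (· ≤ a)) ι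
    ⟨a, by simp⟩
  simp only [Finset.mem_filter, Finset.mem_univ, true_and] at hx hmax
  have hle := hmax a le_rfl
  refine ⟨ι x, mem_rightEnds.2 ?_, hle, by rwa [h.invol]⟩
  rw [h.invol]
  refine ⟨by omega, fun y hy => lt_of_le_of_ne (hmax y (hy.le.trans hx)) fun h1 => ?_⟩
  exact hy.ne (h.injective h1)

/-- Otherwise `ι b'` would lie left of the edge of `b` and be matched beyond it. -/
theorem map_lt_map_of_mem_rightEnds (h : IsMatchingOf E ι) {b b' : Fin N} (hb : b ∈ rightEnds ι)
    (hlt : b < b') : ι b < ι b' := by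
  by_contra! h1
  rcases h1.lt_or_eq with h1 | h1
  · have := (mem_rightEnds.1 hb).2 _ h1
    rw [h.invol] at this
    omega
  · exact hlt.ne (h.injective h1.symm)

theorem map_zero_le [NeZero N] (h : IsMatchingOf E ι) {b : Fin N} (hb : b ∈ rightEnds ι) :
    ι 0 ≤ b := by
  by_contra! h1
  have := h.map_lt_map_of_mem_rightEnds hb h1
  rw [h.invol] at this
  exact Fin.not_lt_zero _ this

/-- In a connected matching, the left end of each nonnested edge lies before the right end of
the preceding nonnested edge, and it is the first point matched beyond this right end. -/
theorem map_lt_of_next (h : IsMatchingOf E ι) (hE : IsConnectedMatching E) {b b' : Fin N}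
    (hb : b ∈ rightEnds ι) (hb' : b' ∈ rightEnds ι) (hlt : b < b')
    (hnext : ∀ t ∈ rightEnds ι, b < t → b' ≤ t) : ι b' < b ∧ ∀ a < ι b', ι a ≤ b := by
  have h1 : ι b' < b := by
    have := (mem_rightEnds.1 hb).1
    -- Some edge covers `b`. A nonnested edge around it, or equal to it, ends at `b'` or later, so
    -- the left end of the edge of `b'` is no further right.
    obtain ⟨a, hab, hba⟩ := h.isConnectedMatching_iff.1 hE b (by omega) (by omega)
    obtain ⟨q, hq, hq1, hq2⟩ := h.exists_rightEnd_ge (hab.trans hba)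
    rcases (hnext q hq (hba.trans_le hq1)).lt_or_eq with h2 | h2
    · have := h.map_lt_map_of_mem_rightEnds hb' h2
      omega
    · rw [h2]
      omega
  refine ⟨h1, fun a ha => ?_⟩
  by_contra! h2
  -- The nonnested edge ending at `q` would start before `ι b'` and end no earlier than `b'`,
  -- contradicting `hb'`.
  obtain ⟨q, hq, hq1, hq2⟩ := h.exists_rightEnd_ge (a := a) (by omega)
  have h3 := hnext q hq (h2.trans_le hq1)
  have h4 := (mem_rightEnds.1 hb').2 (ι q) (by omega)
  rw [h.invol] at h4
  omega

end IsMatchingOf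

/-! ### Removing the additional loop -/

/-- A rooted map with an additional loop, with half-edges labelled by `Fin (2 * n + 2)` so that the
head of the loop is `0`. -/
structure LoopedMap (n k : ℕ) where
  /-- the other end of the same edge -/
  opp : Fin (2 * n + 2) → Fin (2 * n + 2)
  /-- the next half-edge around the same vertex -/
  rot : Equiv.Perm (Fin (2 * n + 2))
  /-- vertices -/
  V : Type
  [fintypeV : Fintype V]
  [nonemptyV : Nonempty V]
  card_V : Fintype.card V = k
  /-- the vertex with which a half-edge is incident -/
  vert : Fin (2 * n + 2) → V
  opp_opp : ∀ d, opp (opp d) = d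
  opp_ne : ∀ d, opp d ≠ d
  rot_opp_zero : rot (opp 0) = 0
  eq_of_rot_zero : rot 0 = opp 0 → ∀ d, d = 0 ∨ d = opp 0
  vert_eq_iff : ∀ x y, vert x = vert y ↔ rot.SameCycle x y
  connected : ∀ u v : V, Relation.ReflTransGen (fun a b => ∃ d, vert d = a ∧ vert (opp d) = b) u v

namespace LoopedMap

variable {n k : ℕ} (L : LoopedMap n k)

attribute [instance] fintypeV nonemptyV

/-- The half-edges that do not belong to the loop. -/
abbrev D : Type := {d : Fin (2 * n + 2) // d ≠ 0 ∧ d ≠ L.opp 0}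

theorem rot_eq_zero_iff {d : Fin (2 * n + 2)} : L.rot d = 0 ↔ d = L.opp 0 := by
  rw [← L.rot_opp_zero, L.rot.injective.eq_iff, L.rot_opp_zero]

theorem rot_zero_ne : L.rot 0 ≠ 0 := fun h => L.opp_ne 0 (L.rot_eq_zero_iff.1 h).symm

/-- The rotation with the loop removed. -/
def rotAux : Equiv.Perm (Fin (2 * n + 2)) :=
  Equiv.swap 0 (L.rot 0) * (Equiv.swap (L.opp 0) 0 * L.rot)

theorem rotAux_of_eq {d : Fin (2 * n + 2)} (hd : L.rot d = L.opp 0) : L.rotAux d = L.rot 0 := by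
  simp [rotAux, hd]

theorem rotAux_of_ne {d : Fin (2 * n + 2)} (h0 : d ≠ 0) (ht : d ≠ L.opp 0)
    (hd : L.rot d ≠ L.opp 0) : L.rotAux d = L.rot d := by
  have h1 : L.rot d ≠ 0 := fun h => ht (L.rot_eq_zero_iff.1 h)
  have h2 : L.rot d ≠ L.rot 0 := L.rot.injective.ne h0
  simp only [rotAux, Equiv.Perm.mul_apply]
  rw [Equiv.swap_apply_of_ne_of_ne hd h1, Equiv.swap_apply_of_ne_of_ne h1 h2]

theorem rotAux_mem {d : Fin (2 * n + 2)} (hd : d ≠ 0 ∧ d ≠ L.opp 0) :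
    L.rotAux d ≠ 0 ∧ L.rotAux d ≠ L.opp 0 := by
  by_cases h : L.rot d = L.opp 0
  · rw [L.rotAux_of_eq h]
    exact ⟨L.rot_zero_ne, fun h1 => hd.1 (L.rot.injective (h.trans h1.symm))⟩
  · rw [L.rotAux_of_ne hd.1 hd.2 h]
    exact ⟨fun h1 => hd.2 (L.rot_eq_zero_iff.1 h1), h⟩

/-- An injection of the finite set of remaining half-edges into itself is onto. -/
theorem rotAux_mem_iff (d : Fin (2 * n + 2)) :
    (L.rotAux d ≠ 0 ∧ L.rotAux d ≠ L.opp 0) ↔ (d ≠ 0 ∧ d ≠ L.opp 0) := by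
  refine ⟨fun h => ?_, L.rotAux_mem⟩
  have hmap : ∀ x ∈ Finset.univ.filter (fun d => d ≠ 0 ∧ d ≠ L.opp 0),
      L.rotAux x ∈ Finset.univ.filter (fun d => d ≠ 0 ∧ d ≠ L.opp 0) := by
    intro x hx
    simpa using L.rotAux_mem (by simpa using hx)
  obtain ⟨x, hx, hxd⟩ := Finset.surj_on_of_inj_on_of_card_le (fun x _ => L.rotAux x) hmap
    (fun _ _ _ _ h => L.rotAux.injective h) le_rfl (L.rotAux d) (by simpa using h)
  rw [L.rotAux.injective hxd]
  simpa using hx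

/-- The rotation of the remaining half-edges. -/
def rotD : Equiv.Perm L.D := L.rotAux.subtypePerm L.rotAux_mem_iff

theorem vert_rot (d : Fin (2 * n + 2)) : L.vert (L.rot d) = L.vert d :=
  (L.vert_eq_iff _ _).2 (Equiv.Perm.sameCycle_apply_left.2 (Equiv.Perm.SameCycle.refl _ _))

theorem vert_opp_zero : L.vert (L.opp 0) = L.vert 0 := by
  rw [← L.vert_rot, L.rot_opp_zero]

theorem vert_rotD (d : L.D) : L.vert (L.rotD d) = L.vert d := by
  change L.vert (L.rotAux d) = _
  by_cases h : L.rot d = L.opp 0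
  · rw [L.rotAux_of_eq h, L.vert_rot, ← L.vert_rot d, h, L.vert_opp_zero]
  · rw [L.rotAux_of_ne d.2.1 d.2.2 h, L.vert_rot]

/-- As soon as a half-edge remains, the one after the loop head remains too and can serve as root.
-/
theorem rot_zero_mem (d : L.D) : L.rot 0 ≠ 0 ∧ L.rot 0 ≠ L.opp 0 :=
  ⟨L.rot_zero_ne, fun h => (L.eq_of_rot_zero h d).elim d.2.1 d.2.2⟩

theorem sameCycle_rotD {x y : L.D} (h : L.rot.SameCycle x y) : L.rotD.SameCycle x y := by
  obtain ⟨i, hi⟩ := h.exists_nat_pow_eq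
  let r : L.D := ⟨L.rot 0, L.rot_zero_mem x⟩
  -- Both ends of the loop collapse to the half-edge after it. A step of `rot` then becomes a step
  -- of `rotD` or no move at all.
  let proj : Fin (2 * n + 2) → L.D := fun d => if hd : d ≠ 0 ∧ d ≠ L.opp 0 then ⟨d, hd⟩ else r
  have hpos : ∀ d (hd : d ≠ 0 ∧ d ≠ L.opp 0), proj d = ⟨d, hd⟩ := fun d hd => dif_pos hd
  have hneg : ∀ d, ¬ (d ≠ 0 ∧ d ≠ L.opp 0) → proj d = r := fun d hd => dif_neg hd
  have hstep : ∀ d, L.rotD.SameCycle (proj d) (proj (L.rot d)) := by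
    intro d
    by_cases hd : d ≠ 0 ∧ d ≠ L.opp 0
    · have : proj (L.rot d) = L.rotD (proj d) := by
        rw [hpos d hd]
        by_cases h1 : L.rot d = L.opp 0
        · rw [hneg _ (by simp [h1])]
          exact Subtype.ext (L.rotAux_of_eq h1).symm
        · rw [hpos _ ⟨fun h2 => hd.2 (L.rot_eq_zero_iff.1 h2), h1⟩]
          exact Subtype.ext (L.rotAux_of_ne hd.1 hd.2 h1).symm
      rw [this]
      exact Equiv.Perm.sameCycle_apply_right.2 (Equiv.Perm.SameCycle.refl _ _)
    · have : proj (L.rot d) = proj d := by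
        rw [hneg d hd]
        rcases (not_and_or.1 hd) with h1 | h1
        · rw [not_not.1 h1, hpos _ (L.rot_zero_mem x)]
        · rw [not_not.1 h1, L.rot_opp_zero, hneg _ (by simp)]
      rw [this]
  have hpow : ∀ j : ℕ, L.rotD.SameCycle x (proj ((L.rot ^ j) x)) := by
    intro j
    induction j with
    | zero =>
      rw [pow_zero, Equiv.Perm.one_apply, hpos _ x.2]
    | succ j ih =>
      rw [pow_succ', Equiv.Perm.mul_apply]
      exact ih.trans (hstep _)
  have := hpow i
  rwa [hi, hpos _ y.2] at this

theorem vert_eq_iff_sameCycle_rotD (x y : L.D) :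
    L.vert x = L.vert y ↔ L.rotD.SameCycle x y := by
  refine ⟨fun h => L.sameCycle_rotD ((L.vert_eq_iff _ _).1 h), fun h => ?_⟩
  obtain ⟨i, rfl⟩ := h.exists_nat_pow_eq
  clear h
  induction i with
  | zero => rfl
  | succ i ih => rw [pow_succ', Equiv.Perm.mul_apply, vert_rotD, ih]

theorem opp_mem {d : Fin (2 * n + 2)} (hd : d ≠ 0 ∧ d ≠ L.opp 0) :
    L.opp d ≠ 0 ∧ L.opp d ≠ L.opp 0 :=
  ⟨fun h => hd.2 (by rw [← h, L.opp_opp]),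
    fun h => hd.1 (by rw [← L.opp_opp d, h, L.opp_opp])⟩

theorem card_D : Fintype.card L.D = 2 * n := by
  have : (Finset.univ.filter fun d => d ≠ 0 ∧ d ≠ L.opp 0) =
      (Finset.univ.erase (0 : Fin (2 * n + 2))).erase (L.opp 0) := by
    ext d
    simp [and_comm]
  rw [Fintype.card_subtype, this, Finset.card_erase_of_mem (by simp [L.opp_ne 0]),
    Finset.card_erase_of_mem (Finset.mem_univ _), Finset.card_univ, Fintype.card_fin]
  omega

theorem connected_D (u v : L.V) : Relation.ReflTransGen
    (fun a b => ∃ d : L.D, L.vert d = a ∧ L.vert (L.opp d) = b) u v := by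
  induction L.connected u v with
  | refl => exact Relation.ReflTransGen.refl
  | tail _ h ih =>
    obtain ⟨d, rfl, rfl⟩ := h
    by_cases hd : d ≠ 0 ∧ d ≠ L.opp 0
    · exact ih.tail ⟨⟨d, hd⟩, rfl, rfl⟩
    · rcases (not_and_or.1 hd) with h1 | h1
      · rw [not_not.1 h1] at ih ⊢
        rwa [L.vert_opp_zero]
      · rw [not_not.1 h1] at ih ⊢
        rwa [L.opp_opp, ← L.vert_opp_zero]

/-- The rooted map obtained by removing the loop. -/
def toRootedMap : RootedMap n k where
  D := L.D
  V := L.V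
  card_D := L.card_D
  card_V := L.card_V
  opp d := ⟨L.opp d, L.opp_mem d.2⟩
  opp_opp d := Subtype.ext (L.opp_opp d)
  opp_ne d h := L.opp_ne d (congrArg Subtype.val h)
  vert d := L.vert d
  rot := L.rotD
  vert_eq_iff := L.vert_eq_iff_sameCycle_rotD
  connected := L.connected_D
  root := if h : L.rot 0 ≠ 0 ∧ L.rot 0 ≠ L.opp 0 then some ⟨L.rot 0, h⟩ else none
  isEmpty_of_root h := ⟨fun d => by simp [L.rot_zero_mem d] at h⟩

theorem exists_equiv : ∃ e : Fin (2 * n + 2) ≃ L.toRootedMap.D',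
    e 0 = L.toRootedMap.loopHead ∧ (∀ i, L.toRootedMap.opp' (e i) = e (L.opp i)) ∧
      ∀ i, L.toRootedMap.rot' (e i) = e (L.rot i) := by
  let c : L.D ⊕ Bool → Fin (2 * n + 2) :=
    Sum.elim Subtype.val fun b => cond b 0 (L.opp 0)
  have hc : Function.Bijective c := by
    rw [Fintype.bijective_iff_surjective_and_card]
    refine ⟨fun d => ?_, by simp [L.card_D]⟩
    by_cases h0 : d = 0
    · exact ⟨Sum.inr true, h0.symm⟩
    · by_cases ht : d = L.opp 0
      · exact ⟨Sum.inr false, ht.symm⟩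
      · exact ⟨Sum.inl ⟨d, h0, ht⟩, rfl⟩
  let g : L.toRootedMap.D' ≃ Fin (2 * n + 2) := Equiv.ofBijective c hc
  have hhead : g L.toRootedMap.loopHead = 0 := rfl
  have htail : g L.toRootedMap.loopTail = L.opp 0 := rfl
  have hopp : ∀ x, g (L.toRootedMap.opp' x) = L.opp (g x) := by
    rintro (x | _ | _)
    · rfl
    · change 0 = L.opp (L.opp 0)
      rw [L.opp_opp]
    · rfl
  have hrot : ∀ x, g (L.toRootedMap.rot' x) = L.rot (g x) := by
    rintro (x | _ | _)
    · have hr : L.toRootedMap.root = some ⟨L.rot 0, L.rot_zero_mem x⟩ := dif_pos _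
      have hx : g (Sum.inl x) = x.val := rfl
      rw [hx]
      by_cases h : L.rot x.val = L.opp 0
      · rw [L.toRootedMap.rot'_inl_of_eq hr (Subtype.ext (L.rotAux_of_eq h)), htail, h]
      · have h1 := L.rotAux_of_ne x.2.1 x.2.2 h
        rw [L.toRootedMap.rot'_inl_of_ne hr fun h2 => ?_]
        · exact h1
        · have h3 : L.rotAux x.val = L.rot 0 := congrArg Subtype.val h2
          rw [h1] at h3
          exact x.2.1 (L.rot.injective h3)
    · change g (L.toRootedMap.rot' L.toRootedMap.loopTail) = L.rot (g L.toRootedMap.loopTail)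
      rw [L.toRootedMap.rot'_loopTail, hhead, htail, L.rot_opp_zero]
    · change g (L.toRootedMap.rot' L.toRootedMap.loopHead) = L.rot (g L.toRootedMap.loopHead)
      rw [hhead]
      by_cases h : L.rot 0 ≠ 0 ∧ L.rot 0 ≠ L.opp 0
      · have hr : L.toRootedMap.root = some ⟨L.rot 0, h⟩ := dif_pos _
        rw [L.toRootedMap.rot'_loopHead_of_some hr]
        rfl
      · have hr : L.toRootedMap.root = none := dif_neg h
        rw [L.toRootedMap.rot'_loopHead_of_none hr, htail]
        by_contra h1
        exact h ⟨L.rot_zero_ne, Ne.symm h1⟩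
  refine ⟨g.symm, ?_, fun i => ?_, fun i => ?_⟩
  · rw [Equiv.symm_apply_eq, hhead]
  · rw [Equiv.eq_symm_apply, hopp, Equiv.apply_symm_apply]
  · rw [Equiv.eq_symm_apply, hrot, Equiv.apply_symm_apply]

end LoopedMap

/-! ### The exploration of the map of a connected matching -/

namespace RootedMap

variable {n k : ℕ} {M : RootedMap n k} {e : Fin (2 * n + 2) ≃ M.D'}

theorem mem_take_ofFn {p b : Fin (2 * n + 2)} : e p ∈ (List.ofFn e).take (b + 1) ↔ p ≤ b := by
  rw [List.mem_take_iff_getElem]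
  simp only [List.length_ofFn, List.getElem_ofFn, e.injective.eq_iff]
  constructor
  · rintro ⟨i, hi, rfl⟩
    rw [Fin.le_def]
    simp only
    omega
  · intro h
    exact ⟨p, by omega, rfl⟩

/-- From `b` the rotation runs through the labels `s, …, b` and first returns to `b` after `b - s +
1` steps. -/
theorem around_eq_of_block {s b : Fin (2 * n + 2)} (hsb : s ≤ b) (hb : M.rot' (e b) = e s)
    (hrot : ∀ i i' : Fin (2 * n + 2), s ≤ i → i < b → i'.val = i.val + 1 →
      M.rot' (e i) = e i') :
    M.around (e b) = ((List.ofFn e).take (b + 1)).drop s := by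
  have hiter : ∀ j (hj : j ≤ b.val - s.val),
      M.rot'^[j + 1] (e b) = e ⟨s + j, by omega⟩ := by
    intro j
    induction j with
    | zero => exact fun _ => hb
    | succ j ih =>
      intro hj
      rw [Function.iterate_succ_apply', ih (by omega)]
      exact hrot _ _ (by rw [Fin.le_def]; simp) (by rw [Fin.lt_def]; simp only; omega) rfl
  have hper : (M.around (e b)).length = b - s + 1 := by
    have hpos := M.minimalPeriod_rot'_pos (e b)
    have hle : Function.minimalPeriod M.rot' (e b) ≤ b - s + 1 := by
      refine Function.IsPeriodicPt.minimalPeriod_le (by omega) ?_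
      change M.rot'^[b.val - s.val + 1] (e b) = e b
      rw [hiter _ le_rfl]
      congr 1
      exact Fin.ext (by simp only; omega)
    have hp : M.rot'^[Function.minimalPeriod M.rot' (e b)] (e b) = e b :=
      Function.iterate_minimalPeriod
    rw [length_around]
    generalize Function.minimalPeriod M.rot' (e b) = p at hpos hle hp
    obtain ⟨j, rfl⟩ := Nat.exists_eq_succ_of_ne_zero hpos.ne'
    rw [Nat.succ_eq_add_one, hiter j (by omega), e.injective.eq_iff, Fin.ext_iff] at hp
    simp only at hp
    omega
  refine List.ext_getElem? fun i => ?_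
  by_cases hi : i < b.val - s.val + 1
  · rw [M.around_getElem? (by omega), hiter i (by omega), List.getElem?_drop,
      List.getElem?_take_of_lt (by omega), List.getElem?_ofFn, dif_pos (by omega)]
  · rw [List.getElem?_eq_none (by omega), List.getElem?_eq_none]
    simp only [List.length_drop, List.length_take, List.length_ofFn]
    omega

variable {ι : Fin (2 * n + 2) → Fin (2 * n + 2)} {E : Finset (Fin (2 * n + 2) × Fin (2 * n + 2))}

/-- Every intermediate list is the prefix of labels up to some right end, and each step extends it
to the next right end. -/
theorem visits_eq_ofFn (h : IsMatchingOf E ι) (hE : IsConnectedMatching E)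
    (hk : (rightEnds ι).card = k) (h0 : e 0 = M.loopHead) (hopp : ∀ i, M.opp' (e i) = e (ι i))
    (hrot : ∀ i s, IsBlockSucc (rightEnds ι) i s → M.rot' (e i) = e s) :
    M.visits = List.ofFn e := by
  classical
  have hblock : ∀ b ∈ rightEnds ι, ∀ s, IsBlockSucc (rightEnds ι) b s →
      M.around (e b) = ((List.ofFn e).take (b + 1)).drop s := by
    intro b hb s hs
    obtain ⟨h1, -⟩ | ⟨-, hsb, hT, -⟩ := id hs
    · exact absurd hb h1
    · refine around_eq_of_block hsb (hrot b s hs) fun i i' hi hib hi' => ?_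
      refine hrot i i' (Or.inl ⟨fun hiT => ?_, hi'⟩)
      exact (hT i hiT hib).not_ge hi
  have hmain : ∀ j, ∃ b ∈ rightEnds ι,
      M.step^[j] (M.around M.loopTail) = (List.ofFn e).take (b + 1) ∧
      (b.val + 1 = 2 * n + 2 ∨ j + 1 ≤ ((rightEnds ι).filter (· ≤ b)).card) := by
    intro j
    induction j with
    | zero =>
      refine ⟨ι 0, h.map_zero_mem_rightEnds, ?_, Or.inr ?_⟩
      · rw [Function.iterate_zero_apply, ← opp'_loopHead, ← h0, hopp,
          hblock (ι 0) h.map_zero_mem_rightEnds 0 (Or.inr ⟨h.map_zero_mem_rightEnds,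
            Fin.zero_le _, fun t ht hlt => absurd (h.map_zero_le ht) hlt.not_ge, Or.inl rfl⟩)]
        rfl
      · rw [Nat.zero_add, Nat.one_le_iff_ne_zero, ← Nat.pos_iff_ne_zero, Finset.card_pos]
        exact ⟨ι 0, Finset.mem_filter.2 ⟨h.map_zero_mem_rightEnds, le_rfl⟩⟩
    | succ j ih =>
      obtain ⟨b, hb, hw, hc⟩ := ih
      rw [Function.iterate_succ_apply', hw]
      by_cases hlast : b.val + 1 = 2 * n + 2
      · refine ⟨b, hb, ?_, Or.inl hlast⟩
        rcases M.step_cases ((List.ofFn e).take (b + 1)) with ⟨-, hs⟩ | ⟨a, d, -, hd, -, -⟩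
        · exact hs
        · refine absurd ?_ hd
          obtain ⟨p, hp⟩ := e.surjective (M.opp' d)
          rw [← hp, mem_take_ofFn]
          omega
      · obtain ⟨b', hb', hle, hmin⟩ :=
          exists_least_ge h.last_mem_rightEnds (⟨b.val + 1, by omega⟩ : Fin (2 * n + 2))
        have hlt : b < b' := by
          rw [Fin.le_def] at hle
          rw [Fin.lt_def]
          exact hle
        have hnext : ∀ t ∈ rightEnds ι, b < t → b' ≤ t := fun t ht hbt => hmin t ht hbt
        obtain ⟨h1, h2⟩ := h.map_lt_of_next hE hb hb' hlt hnext
        have hnot : M.opp' (e (ι b')) ∉ (List.ofFn e).take (b + 1) := by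
          rw [hopp, h.invol, mem_take_ofFn]
          exact hlt.not_ge
        refine ⟨b', hb', ?_, Or.inr ?_⟩
        · rcases M.step_cases ((List.ofFn e).take (b + 1)) with
            ⟨hs, -⟩ | ⟨a, d, ha, hd, hfirst, hs⟩
          · exact absurd (hs _ (mem_take_ofFn.2 h1.le)) hnot
          · have hab := (List.getElem?_eq_some_iff.1 ha).1
            simp only [List.length_take, List.length_ofFn] at hab
            rw [List.getElem?_take_of_lt (by omega), List.getElem?_ofFn, dif_pos (by omega),
              Option.some.injEq] at ha
            -- By `map_lt_of_next` all points before `ι b'` have their partners in the prefix, while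
            -- `ι b'` does not.
            have had : (⟨a, by omega⟩ : Fin (2 * n + 2)) = ι b' := by
              rcases lt_trichotomy (⟨a, by omega⟩ : Fin (2 * n + 2)) (ι b') with h3 | h3 | h3
              · refine absurd ?_ hd
                rw [← ha, hopp, mem_take_ofFn]
                exact h2 _ h3
              · exact h3
              · refine absurd (hfirst (ι b') h3 (e (ι b')) ?_) hnot
                rw [List.getElem?_take_of_lt (by omega), List.getElem?_ofFn, dif_pos (by omega)]
            rw [hs, ← ha, had, hopp, h.invol, hblock b' hb' ⟨b.val + 1, by omega⟩
              (Or.inr ⟨hb', hle, fun t ht htb => ?_, Or.inr ⟨b, hb, rfl⟩⟩)]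
            · have : (List.ofFn e).take (b + 1) = ((List.ofFn e).take (b' + 1)).take (b + 1) := by
                rw [List.take_take, min_eq_left (by omega)]
              rw [this]
              exact List.take_append_drop _ _
            · by_contra h3
              exact htb.not_ge (hmin t ht (not_lt.1 h3))
        · have hc' := hc.resolve_left hlast
          have hsub : insert b' ((rightEnds ι).filter (· ≤ b)) ⊆
              (rightEnds ι).filter (· ≤ b') := by
            intro t ht
            rcases Finset.mem_insert.1 ht with rfl | ht
            · exact Finset.mem_filter.2 ⟨hb', le_rfl⟩
            · obtain ⟨ht1, ht2⟩ := Finset.mem_filter.1 ht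
              exact Finset.mem_filter.2 ⟨ht1, ht2.trans hlt.le⟩
          have := Finset.card_le_card hsub
          have hmem : b' ∉ (rightEnds ι).filter (· ≤ b) := fun ht =>
            hlt.not_ge (Finset.mem_filter.1 ht).2
          rw [Finset.card_insert_of_notMem hmem] at this
          omega
  obtain ⟨b, -, hw, hc⟩ := hmain k
  have hle := Finset.card_le_card (Finset.filter_subset (· ≤ b) (rightEnds ι))
  -- There are only `k` right ends, so `k` steps cannot have passed `k + 1` of them.
  have hlast : b.val + 1 = 2 * n + 2 := hc.resolve_right (by omega)
  unfold visits
  rw [hw, hlast, List.take_of_length_le (by simp)]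

end RootedMap

/-! ### The map of a connected matching -/

theorem IsBlockSucc.exists_perm {N : ℕ} {T : Finset (Fin N)}
    (hT : ∀ i : Fin N, i.val + 1 = N → i ∈ T) :
    ∃ ρ : Equiv.Perm (Fin N), ∀ i, IsBlockSucc T i (ρ i) := by
  choose ρ hρ using exists_isBlockSucc hT
  have hinj : Function.Injective ρ := fun i j h => (hρ i).injective (h ▸ hρ j)
  exact ⟨Equiv.ofBijective ρ (Finite.injective_iff_bijective.1 hinj), hρ⟩

/-- Vertices are the elements of `rightEnds ι`; below, `β i` is the end of the block of `i`. -/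
theorem IsMatchingOf.exists_loopedMap {n k : ℕ}
    {E : Finset (Fin (2 * n + 2) × Fin (2 * n + 2))} {ι : Fin (2 * n + 2) → Fin (2 * n + 2)}
    (h : IsMatchingOf E ι) (hE : IsConnectedMatching E) (hk : (rightEnds ι).card = k) :
    ∃ L : LoopedMap n k, L.opp = ι ∧ ∀ i, IsBlockSucc (rightEnds ι) i (L.rot i) := by
  obtain ⟨ρ, hρ⟩ := IsBlockSucc.exists_perm h.last_mem_rightEnds
  choose β hβ hle hmin using exists_least_ge h.last_mem_rightEnds
  have hβself : ∀ b ∈ rightEnds ι, β b = b := fun b hb =>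
    le_antisymm (hmin b b hb le_rfl) (hle b)
  have hρt : ρ (ι 0) = 0 := (hρ (ι 0)).unique (Or.inr ⟨h.map_zero_mem_rightEnds,
    Fin.zero_le _, fun t ht hlt => absurd (h.map_zero_le ht) hlt.not_ge, Or.inl rfl⟩)
  have hβρ : ∀ i, β (ρ i) = β i := by
    intro i
    rcases hρ i with ⟨h1, h2⟩ | ⟨h1, h2, h3, -⟩
    · refine le_antisymm (hmin _ _ (hβ i) ?_) (hmin _ _ (hβ _) ?_)
      · have h4 := lt_of_le_of_ne (hle i) fun h4 => h1 (h4 ▸ hβ i)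
        omega
      · have := hle (ρ i)
        omega
    · rw [hβself i h1]
      refine le_antisymm (hmin _ _ h1 h2) ?_
      by_contra! h4
      exact (h3 _ (hβ _) h4).not_ge (hle _)
  have hcyc : ∀ i, ρ.SameCycle i (β i) := by
    have : ∀ m (i : Fin (2 * n + 2)), (β i).val - i.val = m → ρ.SameCycle i (β i) := by
      intro m
      induction m with
      | zero =>
        intro i hi
        have := hle i
        rw [show β i = i by omega]
      | succ m ih =>
        intro i hi
        rcases hρ i with ⟨-, h2⟩ | ⟨h1, -⟩
        · have := ih (ρ i) (by rw [hβρ]; omega)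
          rw [hβρ] at this
          exact Equiv.Perm.sameCycle_apply_left.1 this
        · rw [hβself i h1] at hi
          omega
    exact fun i => this _ i rfl
  have hiff : ∀ x y, (⟨β x, hβ x⟩ : {b // b ∈ rightEnds ι}) = ⟨β y, hβ y⟩ ↔
      ρ.SameCycle x y := by
    intro x y
    rw [Subtype.mk.injEq]
    refine ⟨fun hxy => (hcyc x).trans (hxy ▸ (hcyc y).symm), fun hxy => ?_⟩
    obtain ⟨i, rfl⟩ := hxy.exists_nat_pow_eq
    clear hxy
    induction i with
    | zero => rfl
    | succ i ih => rw [pow_succ', Equiv.Perm.mul_apply, hβρ, ← ih]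
  let R : {b // b ∈ rightEnds ι} → {b // b ∈ rightEnds ι} → Prop := fun a b =>
    ∃ d, (⟨β d, hβ d⟩ : {b // b ∈ rightEnds ι}) = a ∧ ⟨β (ι d), hβ (ι d)⟩ = b
  have hsymm : Std.Symm R := ⟨by
    rintro _ _ ⟨d, rfl, rfl⟩
    exact ⟨ι d, rfl, by simp [h.invol]⟩⟩
  -- The edge that ends a block other than the first leads to an earlier block, so strong induction
  -- on the end reaches the first block.
  have hreach : ∀ m (u : {b // b ∈ rightEnds ι}), u.val.val = m →
      Relation.ReflTransGen R u ⟨ι 0, h.map_zero_mem_rightEnds⟩ := by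
    intro m
    induction m using Nat.strong_induction_on with
    | _ m ih =>
      rintro ⟨b, hb⟩ rfl
      rcases hρ b with ⟨h1, -⟩ | ⟨-, h2, h3, h4⟩
      · exact absurd hb h1
      · rcases h4 with h4 | ⟨t, ht, h4⟩
        · have : b = ι 0 := by
            refine le_antisymm ?_ (h.map_zero_le hb)
            by_contra! h5
            have := h3 _ h.map_zero_mem_rightEnds h5
            omega
          subst this
          exact Relation.ReflTransGen.refl
        · have h5 := (h.map_lt_of_next hE ht hb (by omega) fun t' ht' htt => by
            by_contra! h6
            have := h3 t' ht' h6
            omega).1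
          have h6 := hmin (ι b) t ht h5.le
          refine Relation.ReflTransGen.head ⟨b, Subtype.ext (hβself b hb), rfl⟩
            (ih (β (ι b)).val ?_ ⟨β (ι b), hβ _⟩ rfl)
          simp only
          omega
  refine ⟨{ opp := ι, rot := ρ, V := {b // b ∈ rightEnds ι},
            nonemptyV := ⟨⟨_, h.map_zero_mem_rightEnds⟩⟩, card_V := by rw [Fintype.card_coe, hk],
            vert := fun i => ⟨β i, hβ i⟩, opp_opp := h.invol, opp_ne := h.ne,
            rot_opp_zero := hρt, eq_of_rot_zero := fun h1 => ?_, vert_eq_iff := hiff,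
            connected := fun u v => (hreach _ u rfl).trans ?_ }, rfl, hρ⟩
  · rcases hρ 0 with ⟨-, h3⟩ | ⟨h2, -⟩
    · rw [Fin.val_zero, h1] at h3
      have h4 : n = 0 := by
        by_contra h5
        -- Now `ι 0` is the point 1. If it were not the last point, it would be nested by an edge
        -- starting at 0, but that edge ends at 1.
        obtain ⟨a, ha, ha'⟩ := h.isConnectedMatching_iff.1 hE (ι 0) (by omega) (by omega)
        have : a = 0 := Fin.ext (by rw [Fin.val_zero]; omega)
        rw [this] at ha'
        exact lt_irrefl _ ha'
      intro d
      rcases Nat.eq_zero_or_pos d.val with h5 | h5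
      · exact Or.inl (Fin.ext (by simpa using h5))
      · exact Or.inr (Fin.ext (by omega))
    · exact absurd (mem_rightEnds.1 h2).1 (Fin.not_lt_zero _)
  · exact Relation.ReflTransGen.stdSymm.symm _ _ (hreach _ v rfl)

theorem exists_toMatching_eq {n k : ℕ} {E : Finset (Fin (2 * n + 2) × Fin (2 * n + 2))}
    (hE : IsConnectedMatching E) (hk : 1 ≤ k)
    (hw : matchingWeight E = Polynomial.X ^ (k - 1)) :
    ∃ M : RootedMap n k, M.toMatching = E := by
  obtain ⟨ι, h⟩ := hE.1.exists_isMatchingOf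
  have hcard := (h.matchingWeight_eq_iff hk).1 hw
  obtain ⟨L, rfl, hL⟩ := h.exists_loopedMap hE hcard
  obtain ⟨e, h0, hopp, hrot⟩ := L.exists_equiv
  have hv := RootedMap.visits_eq_ofFn h hE hcard h0 hopp fun i s hs => by
    rw [hrot, (hL i).unique hs]
  refine ⟨L.toRootedMap, (RootedMap.isMatchingOf_toMatching (e := e) (fun i => ?_) hopp).ext h⟩
  rw [hv, List.getElem?_ofFn, dif_pos i.isLt]

theorem theoremt (n k : ℕ) (hk : 1 ≤ k) :
    (∀ M : RootedMap n k, M.weight = Polynomial.X ^ (k - 1) ∧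
      matchingWeight M.toMatching = M.weight) ∧
    Set.BijOn (RootedMap.Class.toMatching n k) Set.univ
      {E | IsConnectedMatching E ∧ matchingWeight E = Polynomial.X ^ (k - 1)} := by
  have hweight : ∀ M : RootedMap n k, matchingWeight M.toMatching = Polynomial.X ^ (k - 1) := by
    intro M
    obtain ⟨ι, e, h⟩ := M.exists_isLabelling
    exact h.matchingWeight_eq
  refine ⟨fun M => ⟨M.weight_eq, (hweight M).trans M.weight_eq.symm⟩, ?_, ?_, ?_⟩
  · rintro ⟨M⟩ -
    obtain ⟨ι, e, h⟩ := M.exists_isLabelling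
    exact ⟨h.connected, hweight M⟩
  · rintro ⟨M⟩ - ⟨M'⟩ - h
    exact Quotient.sound (RootedMap.nonempty_iso_of_toMatching_eq h)
  · rintro E ⟨hE, hw⟩
    obtain ⟨M, rfl⟩ := exists_toMatching_eq hE hk hw
    exact ⟨Quotient.mk _ M, trivial, rfl⟩
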